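/- Let $R$ be a commutative artinian ring, $E$ an injective envelope of $R/\mathrm{rad}(R)$, and $\mathcal C$ a dualizing $R$-variety: a small additive $R$-linear category in which idempotents split, all $\mathcal C(X,Y)$ are finitely generated $R$-modules, and $\mathbb D_{\mathcal C}(M)=\mathrm{Hom}_R(M(-),E)$ induces a duality $\mathrm{mod}(\mathcal C)\to\mathrm{mod}(\mathcal C^{op})$. Here $\mathrm{Mod}(\mathcal C)$ is the category of additive covariant functors $\mathcal C\to\mathbf{Ab}$ (an $R$-module structure on $M(X)$ being given by the action of $R\cdot 1_X$), and $\mathrm{mod}(\mathcal C)$ is the full subcategory of those $M$ for which there is an exact sequence $\mathrm{Hom}_{\mathcal C}(C_0,-)\to\mathrm{Hom}_{\mathcal C}(C_1,-)\to M\to 0$. Let $C\in\mathcal C$, $P=\mathrm{Hom}_{\mathcal C}(C,-)$, and let $\mathcal I=\mathrm{Tr}_P\mathcal C$ be the ideal of $\mathcal C$ in which $\mathcal I(A,B)\subseteq\mathcal C(A,B)$ is the sum of the images of the maps $\varphi_B:P(B)\to\mathcal C(A,B)$ over all morphisms $\varphi:P\to\mathrm{Hom}_{\mathcal C}(A,-)$.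 Let $\pi:\mathcal C\to\mathcal C/\mathcal I$ be the quotient functor. For $k \in \mathbb N$, the ideal $\mathcal I$ is called $k$-idempotent if for all $F,F'\in\mathrm{Mod}(\mathcal C/\mathcal I)$ and $0\le i\le k$ the canonical map $$\mathrm{Ext}^i_{\mathrm{Mod}(\mathcal C/\mathcal I)}(F,F')\to\mathrm{Ext}^i_{\mathrm{Mod}(\mathcal C)}(F\circ\pi,F'\circ\pi)$$ is an isomorphism. Let $J$ be the injective envelope in $\mathrm{mod}(\mathcal C)$ of $P/\mathrm{rad}(P)$, where $\mathrm{rad}(P)$ is the intersection of the maximal submodules of $P$, and let $\mathrm{add}(J)$ consist of the direct summands of the finite powers $J^n$. For $0\le k\le\infty$ let $\mathbb I_k$ be the full subcategory of $\mathrm{mod}(\mathcal C)$ of the modules $Y$ having an injective coresolution $0\to Y\to J_0\to J_1\to\cdots$ in $\mathrm{mod}(\mathcal C)$ with $J_i\in\mathrm{add}(J)$ for all (finite) $i$ with $0\le i\le k$. The following are equivalent: (a) $\mathcal I$ is $2$-idempotent and $\mathbb I_1=\mathbb I_\infty$; (b) $\mathcal I(C',-)$ is a projective $\mathcal C$-module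 for every $C'\in\mathcal C$. -/

import Mathlib

open CategoryTheory CategoryTheory.Limits Opposite

universe u

noncomputable section

namespace RMod

/-! ### Modules over a small preadditive category -/

section Modules

variable (C : Type u) [SmallCategory C] [Preadditive C]

/-- `C`-modules: additive covariant functors from `C` to abelian groups. -/
abbrev Mod : Type (u + 1) := C ⥤+ AddCommGrpCat.{u}

variable {C}

lemma additive_of_isLimit {J : Type} [SmallCategory J] {K : J ⥤ (C ⥤ AddCommGrpCat.{u})}
    (hK : ∀ j, (K.obj j).Additive) {c : Cone K} (hc : IsLimit c) : c.pt.Additive where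
  map_add {X Y f g} := by
    refine (isLimitOfPreserves ((evaluation C AddCommGrpCat.{u}).obj Y) hc).hom_ext fun j => ?_
    have := hK j
    simp [Preadditive.add_comp, NatTrans.naturality]

lemma additive_of_isColimit {J : Type} [SmallCategory J] {K : J ⥤ (C ⥤ AddCommGrpCat.{u})}
    (hK : ∀ j, (K.obj j).Additive) {c : Cocone K} (hc : IsColimit c) : c.pt.Additive where
  map_add {X Y f g} := by
    refine (isColimitOfPreserves ((evaluation C AddCommGrpCat.{u}).obj X) hc).hom_ext fun j => ?_
    have := hK j
    simp [Preadditive.comp_add, ← NatTrans.naturality]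

instance closedUnderLimits (J : Type) [SmallCategory J] :
    (additiveFunctor C AddCommGrpCat.{u}).IsClosedUnderLimitsOfShape J where
  limitsOfShape_le := by
    rintro F ⟨h⟩
    exact additive_of_isLimit h.prop_diag_obj h.isLimit

instance closedUnderColimits (J : Type) [SmallCategory J] :
    (additiveFunctor C AddCommGrpCat.{u}).IsClosedUnderColimitsOfShape J where
  colimitsOfShape_le := by
    rintro F ⟨h⟩
    exact additive_of_isColimit h.prop_diag_obj h.isColimit

instance closedUnderKernels : (additiveFunctor C AddCommGrpCat.{u}).IsClosedUnderKernels where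
  kernels_le := by
    rintro F ⟨f, k, hk, hX, hY⟩
    refine additive_of_isLimit ?_ hk
    rintro (_ | _)
    exacts [hX, hY]

instance closedUnderCokernels : (additiveFunctor C AddCommGrpCat.{u}).IsClosedUnderCokernels where
  cokernels_le := by
    rintro F ⟨f, k, hk, hX, hY⟩
    refine additive_of_isColimit ?_ hk
    rintro (_ | _)
    exacts [hX, hY]

instance closedUnderFiniteProducts :
    (additiveFunctor C AddCommGrpCat.{u}).IsClosedUnderFiniteProducts :=
  .of_isClosedUnderLimitsOfShape.{0} fun _ _ => inferInstance

instance containsZero : (additiveFunctor C AddCommGrpCat.{u}).ContainsZero where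
  exists_zero :=
    have h : IsZero (AddCommGrpCat.of PUnit.{u + 1}) := AddCommGrpCat.isZero_of_subsingleton _
    ⟨(Functor.const C).obj (AddCommGrpCat.of PUnit), (Functor.isZero_iff _).2 fun _ => h,
      ⟨fun {_ _ _ _} => h.eq_of_src _ _⟩⟩

instance : HasFiniteBiproducts (Mod C) := Abelian.hasFiniteBiproducts

/-- The `C`-module `Hom_C(X, -)`. -/
def rep (X : C) : Mod C := ⟨preadditiveCoyoneda.obj (op X), inferInstanceAs (Functor.Additive _)⟩

/-- `M` is finitely presented: there is an exact sequence
`Hom_C(C₀, -) ⟶ Hom_C(C₁, -) ⟶ M ⟶ 0`. -/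
def IsFinPres : ObjectProperty (Mod C) := fun M =>
  ∃ (C₀ C₁ : C) (f : rep C₀ ⟶ rep C₁) (p : rep C₁ ⟶ M) (w : f ≫ p = 0),
    (ShortComplex.mk f p w).Exact ∧ Epi p

/-- The additive closure of `M`: the modules `X` with `X ⊕ Y ≅ M^n` for some `Y` and `n`. -/
def add (M : Mod C) : ObjectProperty (Mod C) := fun X =>
  ∃ (Y : Mod C) (n : ℕ), Nonempty (X ⊞ Y ≅ ⨁ fun _ : Fin n => M)

end Modules

/-- The category `mod(C)` of finitely presented `C`-modules. -/
abbrev FpMod (C : Type u) [SmallCategory C] [Preadditive C] : Type (u + 1) :=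
  (IsFinPres (C := C)).FullSubcategory

/-- Restriction of modules along an additive functor `F`: `M ↦ M ∘ F`. -/
def restrict {C D : Type u} [SmallCategory C] [Preadditive C] [SmallCategory D] [Preadditive D]
    (F : C ⥤ D) [F.Additive] : Mod D ⥤ Mod C :=
  (additiveFunctor C AddCommGrpCat.{u}).lift
    (AdditiveFunctor.forget D AddCommGrpCat.{u} ⋙
      (Functor.whiskeringLeft C D AddCommGrpCat.{u}).obj F)
    (fun M => inferInstanceAs (F ⋙ M.obj).Additive)

section Restrict

variable {C D : Type u} [SmallCategory C] [Preadditive C] [SmallCategory D] [Preadditive D]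
  (F : C ⥤ D) [F.Additive]

instance : (restrict F).Additive where

instance : PreservesFiniteLimits (restrict F) where
  preservesFiniteLimits J _ _ := by
    have : PreservesLimitsOfShape J (restrict F ⋙ AdditiveFunctor.forget C AddCommGrpCat.{u}) :=
      inferInstanceAs (PreservesLimitsOfShape J (AdditiveFunctor.forget D AddCommGrpCat.{u} ⋙
        (Functor.whiskeringLeft C D AddCommGrpCat.{u}).obj F))
    exact preservesLimitsOfShape_of_reflects_of_preserves _
      (AdditiveFunctor.forget C AddCommGrpCat.{u})

instance : PreservesFiniteColimits (restrict F) where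
  preservesFiniteColimits J _ _ := by
    have : PreservesColimitsOfShape J (restrict F ⋙ AdditiveFunctor.forget C AddCommGrpCat.{u}) :=
      inferInstanceAs (PreservesColimitsOfShape J (AdditiveFunctor.forget D AddCommGrpCat.{u} ⋙
        (Functor.whiskeringLeft C D AddCommGrpCat.{u}).obj F))
    exact preservesColimitsOfShape_of_reflects_of_preserves _
      (AdditiveFunctor.forget C AddCommGrpCat.{u})

end Restrict

/-! ### Submodules, trace and radical -/

section Submodules

variable {C : Type u} [SmallCategory C] [Preadditive C]

/-- A submodule (additive subfunctor) of a `C`-module. -/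
@[ext]
structure Sub (M : Mod C) where
  carrier : ∀ X : C, AddSubgroup (M.obj.obj X)
  map_mem : ∀ {X Y : C} (f : X ⟶ Y) {x : M.obj.obj X},
    x ∈ carrier X → M.obj.map f x ∈ carrier Y

namespace Sub

variable {M : Mod C}

/-- Submodules are ordered by inclusion. -/
instance : PartialOrder (Sub M) := PartialOrder.lift Sub.carrier fun _ _ h => Sub.ext h

instance : OrderTop (Sub M) where
  top := ⟨fun _ => ⊤, fun _ _ _ => AddSubgroup.mem_top _⟩
  le_top _ _ := le_top

/-- A submodule, as a `C`-module in its own right. -/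
def toMod (N : Sub M) : Mod C :=
  ⟨{ obj := fun X => AddCommGrpCat.of (N.carrier X)
     map := fun {X Y} f => AddCommGrpCat.ofHom
      (((M.obj.map f).hom.comp (N.carrier X).subtype).codRestrict (N.carrier Y)
        fun x => N.map_mem f x.2) },
   { map_add := by
      intro X Y f g
      refine ConcreteCategory.hom_ext _ _ fun x => Subtype.ext (?_ : M.obj.map (f + g) x.1 = M.obj.map f x.1 + M.obj.map g x.1)
      rw [Functor.map_add]
      rfl }⟩

/-- The inclusion of a submodule. -/
def ι (N : Sub M) : N.toMod ⟶ M :=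
  ObjectProperty.homMk { app := fun X => AddCommGrpCat.ofHom (N.carrier X).subtype }

/-- The quotient module `M / N`. -/
def quotient (N : Sub M) : Mod C := cokernel N.ι

end Sub

/-- The radical of `M`: the intersection of the maximal submodules of `M`. -/
def rad (M : Mod C) : Sub M where
  carrier X := ⨅ (N : Sub M) (_ : IsCoatom N), N.carrier X
  map_mem f x hx := by
    simp only [AddSubgroup.mem_iInf] at hx ⊢
    exact fun N hN => N.map_mem f (hx N hN)

/-- The trace of `P` in `M`: the sum of the images of all morphisms `P ⟶ M`. -/
def trace (P M : Mod C) : Sub M where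
  carrier X := ⨆ φ : P ⟶ M, (φ.hom.app X).hom.range
  map_mem {X Y} f x hx := by
    suffices h : AddSubgroup.map (M.obj.map f).hom (⨆ φ : P ⟶ M, (φ.hom.app X).hom.range) ≤
        ⨆ φ : P ⟶ M, (φ.hom.app Y).hom.range from h ⟨x, hx, rfl⟩
    rw [AddSubgroup.map_iSup]
    refine iSup_mono fun φ => ?_
    rintro _ ⟨_, ⟨x, rfl⟩, rfl⟩
    exact ⟨P.obj.map f x, ConcreteCategory.congr_hom (φ.hom.naturality f) x⟩

end Submodules

/-! ### Ideals and quotient categories -/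

/-- A (two-sided) ideal of a preadditive category. -/
structure CatIdeal (C : Type u) [SmallCategory C] [Preadditive C] where
  hom : ∀ A B : C, AddSubgroup (A ⟶ B)
  comp_mem : ∀ {A' A B B' : C} (g : A' ⟶ A) {f : A ⟶ B} (h : B ⟶ B'),
    f ∈ hom A B → g ≫ f ≫ h ∈ hom A' B'

namespace CatIdeal

variable {C : Type u} [SmallCategory C] [Preadditive C] (I : CatIdeal C)

/-- The `C`-module `I(A, -)`, as a submodule of `Hom_C(A, -)`. -/
def homSub (A : C) : Sub (rep A) where
  carrier B := I.hom A B
  map_mem f x hx := by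
    have := I.comp_mem (𝟙 A) f hx
    rw [Category.id_comp] at this
    exact this

/-- Two parallel morphisms are identified in `C/I` iff their difference lies in `I`. -/
def rel : HomRel C := fun A B f g => f - g ∈ I.hom A B

instance : Congruence I.rel where
  equivalence :=
    { refl := fun f => by simp [rel, (I.hom _ _).zero_mem]
      symm := fun {f g} h => by
        have := (I.hom _ _).neg_mem h
        rwa [neg_sub] at this
      trans := fun {f g k} h₁ h₂ => by
        have := (I.hom _ _).add_mem h₁ h₂
        rwa [sub_add_sub_cancel] at this }
  comp_left f g g' h := by
    have := I.comp_mem f (𝟙 _) h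
    simpa [rel, Preadditive.comp_sub] using this
  comp_right g h := by
    have := I.comp_mem (𝟙 _) g h
    simpa [rel, Preadditive.sub_comp] using this

lemma rel_add ⦃A B : C⦄ (f₁ f₂ g₁ g₂ : A ⟶ B) (hf : I.rel f₁ f₂) (hg : I.rel g₁ g₂) :
    I.rel (f₁ + g₁) (f₂ + g₂) := by
  have := (I.hom _ _).add_mem hf hg
  rwa [sub_add_sub_comm] at this

/-- The quotient category `C/I`. -/
abbrev Quot : Type u := CategoryTheory.Quotient I.rel

instance : Preadditive I.Quot := CategoryTheory.Quotient.preadditive I.rel I.rel_add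

/-- The canonical functor `C ⥤ C/I`. -/
abbrev π : C ⥤ I.Quot := CategoryTheory.Quotient.functor I.rel

instance : I.π.Additive := CategoryTheory.Quotient.functor_additive I.rel I.rel_add

/-- `I` is `k`-idempotent: for all `C/I`-modules `F`, `F'` and all `i ≤ k`, the map
`Ext^i_{Mod(C/I)}(F, F') ⟶ Ext^i_{Mod(C)}(F ∘ π, F' ∘ π)` induced by the exact functor
`F ↦ F ∘ π` is an isomorphism. -/
def IsIdempotent (k : ℕ) : Prop :=
  letI : HasExt.{u + 1} (Mod I.Quot) := HasExt.standard _
  letI : HasExt.{u + 1} (Mod C) := HasExt.standard _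
  ∀ (F F' : Mod I.Quot) (i : ℕ), i ≤ k →
    Function.Bijective ((restrict I.π).mapExtAddHom F F' i)

end CatIdeal

/-- The trace ideal `Tr_P C`, given by `(Tr_P C)(A, B) = Tr_P(Hom_C(A, -))(B)`. -/
def traceIdeal {C : Type u} [SmallCategory C] [Preadditive C] (P : Mod C) : CatIdeal C where
  hom A B := (trace P (rep A)).carrier B
  comp_mem {A' A B B'} g f h hf := by
    have hf' : g ≫ f ∈ (trace P (rep A')).carrier B := by
      let γ : rep A ⟶ rep A' := ObjectProperty.homMk (preadditiveCoyoneda.map g.op)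
      suffices h : AddSubgroup.map (γ.hom.app B).hom ((trace P (rep A)).carrier B) ≤
          (trace P (rep A')).carrier B from h ⟨f, hf, rfl⟩
      dsimp only [trace]
      rw [AddSubgroup.map_iSup]
      refine iSup_le fun φ => le_trans ?_ (le_iSup _ (φ ≫ γ))
      rintro _ ⟨_, ⟨x, rfl⟩, rfl⟩
      exact ⟨x, rfl⟩
    rw [← Category.assoc]
    exact (trace P (rep A')).map_mem h hf'

/-! ### Injective envelopes -/

/-- `i : S ⟶ E` is an injective envelope: `E` is injective and `i` is an essential
monomorphism. -/
structure IsInjectiveEnvelope {A : Type*} [Category A] {S E : A} (i : S ⟶ E) : Prop where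
  injective : Injective E
  mono : Mono i
  essential : ∀ {T : A} (g : E ⟶ T), Mono (i ≫ g) → Mono g

/-! ### Dualizing varieties -/

section Dualizing

variable (R : Type u) [CommRing R] {C : Type u} [SmallCategory C] [Preadditive C] [Linear R C]

/-- The `R`-module structure on `M(X)`: the scalar `r` acts as `M(r • 𝟙 X)`. -/
abbrev moduleObj (M : Mod C) (X : C) : Module R (M.obj.obj X) where
  smul r x := M.obj.map (r • 𝟙 X) x
  one_smul x := by
    change M.obj.map ((1 : R) • 𝟙 X) x = x
    simp
  mul_smul r s x := by
    change M.obj.map ((r * s) • 𝟙 X) x = M.obj.map (r • 𝟙 X) (M.obj.map (s • 𝟙 X) x)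
    rw [← ConcreteCategory.comp_apply, ← Functor.map_comp]
    rw [Linear.smul_comp, Linear.comp_smul, Category.comp_id, smul_smul, mul_comm]
  smul_zero r := map_zero (M.obj.map (r • 𝟙 X)).hom
  smul_add r := map_add (M.obj.map (r • 𝟙 X)).hom
  add_smul r s x := by
    change M.obj.map ((r + s) • 𝟙 X) x = M.obj.map (r • 𝟙 X) x + M.obj.map (s • 𝟙 X) x
    rw [add_smul, Functor.map_add]
    rfl
  zero_smul x := by
    change M.obj.map ((0 : R) • 𝟙 X) x = 0
    rw [zero_smul, Functor.map_zero]
    rfl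

/-- A `C`-module viewed as a functor from `C` to `R`-modules. -/
def toModuleCat : Mod C ⥤ C ⥤ ModuleCat.{u} R where
  obj M :=
    { obj := fun X =>
        letI := moduleObj R M X
        ModuleCat.of R (M.obj.obj X)
      map := fun {X Y} f =>
        letI := moduleObj R M X
        letI := moduleObj R M Y
        ModuleCat.ofHom
          { toFun := fun x => M.obj.map f x
            map_add' := map_add (M.obj.map f).hom
            map_smul' := fun r x => by
              change M.obj.map f (M.obj.map (r • 𝟙 X) x) = M.obj.map (r • 𝟙 Y) (M.obj.map f x)
              simp only [← ConcreteCategory.comp_apply, ← Functor.map_comp]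
              simp }
      map_id := fun X => by
        refine ConcreteCategory.hom_ext _ _ fun x => ?_
        exact ConcreteCategory.congr_hom (M.obj.map_id X) x
      map_comp := fun f g => by
        refine ConcreteCategory.hom_ext _ _ fun x => ?_
        exact ConcreteCategory.congr_hom (M.obj.map_comp f g) x }
  map {M N} φ :=
    { app := fun X =>
        letI := moduleObj R M X
        letI := moduleObj R N X
        ModuleCat.ofHom
          { toFun := fun x => φ.hom.app X x
            map_add' := map_add (φ.hom.app X).hom
            map_smul' := fun r x =>
              ConcreteCategory.congr_hom (φ.hom.naturality (r • 𝟙 X)) x }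
      naturality := fun X Y f => by
        refine ConcreteCategory.hom_ext _ _ fun x => ?_
        exact ConcreteCategory.congr_hom (φ.hom.naturality f) x }

lemma toModuleCat_obj_additive (M : Mod C) : ((toModuleCat R).obj M).Additive where
  map_add {X Y f g} := by
    ext x
    exact ConcreteCategory.congr_hom (M.obj.map_add (f := f) (g := g)) x

/-- The contravariant functor `D_C : Mod(C) ⥤ Mod(Cᵒᵖ)`, `D_C(M)(X) = Hom_R(M(X), E)`. -/
def dual (E : ModuleCat.{u} R) : (Mod C)ᵒᵖ ⥤ Mod Cᵒᵖ where
  obj M :=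
    ⟨((toModuleCat R).obj M.unop).op ⋙ preadditiveYoneda.obj E, by
      have := toModuleCat_obj_additive R M.unop
      exact inferInstanceAs (Functor.Additive (_ ⋙ _))⟩
  map φ := ObjectProperty.homMk
    (Functor.whiskerRight (NatTrans.op ((toModuleCat R).map φ.unop)) (preadditiveYoneda.obj E))

variable (C)

/-- A dualizing `R`-variety, for a commutative artin ring `R`: a small additive `R`-linear
category in which idempotents split, with finitely generated Hom-modules, such that
`D_C = Hom_R(-, E)`, for an injective envelope `E` of `R / rad R`, induces a duality between
the finitely presented `C`-modules and the finitely presented `Cᵒᵖ`-modules. -/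
structure IsDualizingVariety : Prop where
  isArtinianRing : IsArtinianRing R
  hasFiniteBiproducts : HasFiniteBiproducts C
  isIdempotentComplete : IsIdempotentComplete C
  homFinite : ∀ X Y : C, Module.Finite R (X ⟶ Y)
  duality : ∃ (E : ModuleCat.{u} R) (i : ModuleCat.of R (R ⧸ Ring.jacobson R) ⟶ E)
    (_ : IsInjectiveEnvelope i)
    (h : ∀ M : Mod C, IsFinPres M → IsFinPres ((dual R E).obj (op M))),
    ((IsFinPres (C := Cᵒᵖ)).lift ((IsFinPres (C := C)).ι.op ⋙ dual R E)
      fun M => h _ M.unop.property).IsEquivalence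

end Dualizing

/-! ### The subcategories `𝕀_k` -/

section

variable {C : Type u} [SmallCategory C] [Preadditive C]

/-- An exact sequence of `C`-modules `0 ⟶ Y ⟶ J 0 ⟶ J 1 ⟶ ⋯` in which all terms are
finitely presented and all `J n` are injective objects of `mod(C)`. -/
structure InjCoresolution (Y : FpMod C) where
  J : ℕ → FpMod C
  injective : ∀ n, Injective (J n)
  ε : Y ⟶ J 0
  d : ∀ n, J n ⟶ J (n + 1)
  mono : Mono ε.hom
  ε_d : ε.hom ≫ (d 0).hom = 0
  d_d : ∀ n, (d n).hom ≫ (d (n + 1)).hom = 0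
  exact_zero : (ShortComplex.mk _ _ ε_d).Exact
  exact_succ : ∀ n, (ShortComplex.mk _ _ (d_d n)).Exact

/-- `𝕀_k` with respect to `P`: the finitely presented `C`-modules having an injective
coresolution `0 ⟶ Y ⟶ J₀ ⟶ J₁ ⟶ ⋯` in `mod(C)` with `Jₙ ∈ add(J)` for all `n ≤ k`, where
`J` is the injective envelope of `P / rad P` in `mod(C)`. -/
def InI (P : Mod C) (k : ℕ∞) : ObjectProperty (FpMod C) := fun Y =>
  ∃ (S J : FpMod C) (_ : S.obj ≅ (rad P).quotient) (i : S ⟶ J) (_ : IsInjectiveEnvelope i)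
    (r : InjCoresolution Y), ∀ n : ℕ, (n : ℕ∞) ≤ k → add J.obj (r.J n).obj

end

end RMod

end

/-! The ideal I = Tr_P C consists of the sums of morphisms factoring through X, so the modules over
C/I are the C-modules vanishing at X. Call a module torsion free if it has no nonzero submodule
vanishing at X. The duality gives mod(C) kernels and injective envelopes. The envelope J of the top
of P = Hom(X, -) is torsion free, and the torsion submodule of a finitely presented Y is the kernel
of some Y ⟶ J^n (`exists_kernel_torsion`); in particular torsion free finitely presented modules
embed in powers of J.

(a) ⇒ (b). Since I(A, -) has a presentation 0 ⟶ K ⟶ Hom(W, -) ⟶ I(A, -) ⟶ 0 with K finitely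
presented, it suffices that Ext¹(I(A, -), Y) = 0 for finitely presented Y: then the presentation
splits. Dividing Y by its torsion leaves two cases. If Y vanishes at X, then Ext¹(I(A, -), Y) embeds
in Ext² of (C/I)(A, -) with values in Y, which 2-idempotence computes over C/I, where (C/I)(A, -) is
projective. If Y is torsion free, embed it in J^n and let Y' be the preimage of the torsion of
J^n/Y. Then Y' lies in 𝕀₁ = 𝕀_∞, which forces Ext¹(I(A, -), Y') = 0, and Hom(I(A, -), Y'/Y) = 0
because I(A, -) is generated by its value at X.

(b) ⇒ (a). A C/I-module F has a projective cover-like surjection from Q, where 0 ⟶ N ⟶ P' ⟶ Q ⟶ 0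
with P' a coproduct of representables and N the matching coproduct of modules I(A, -). As N is
projective and has no nonzero map to a C/I-module, all positive Ext over C from Q to C/I-modules
vanish, and dimension shifting gives idempotence in all degrees. For 𝕀₁ = 𝕀_∞, the members of 𝕀₁ are
trace closed (`IsTraceClosed`), and under (b) so is the cokernel of an embedding of a trace closed
module in a power of J; hence the coresolution continues forever in add(J). -/

noncomputable section

namespace RMod

/-! ### Elementwise calculus and Yoneda for modules -/

section Pointwise

variable {C : Type u} [SmallCategory C] [Preadditive C]

lemma Mod.hom_ext' {M N : Mod C} {φ ψ : M ⟶ N}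
    (h : ∀ A (x : M.obj.obj A), φ.hom.app A x = ψ.hom.app A x) : φ = ψ := by
  apply ObjectProperty.hom_ext
  ext A x
  exact h A x

@[simp]
lemma comp_app {M N K : Mod C} (φ : M ⟶ N) (ψ : N ⟶ K) {A : C} (x : M.obj.obj A) :
    (φ ≫ ψ).hom.app A x = ψ.hom.app A (φ.hom.app A x) := rfl

@[simp]
lemma zero_app {M N : Mod C} {A : C} (x : M.obj.obj A) : (0 : M ⟶ N).hom.app A x = 0 := rfl

lemma app_map {M N : Mod C} (φ : M ⟶ N) {A B : C} (f : A ⟶ B) (x : M.obj.obj A) :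
    φ.hom.app B (M.obj.map f x) = N.obj.map f (φ.hom.app A x) :=
  ConcreteCategory.congr_hom (φ.hom.naturality f) x

lemma map_comp_apply (M : Mod C) {A B D : C} (f : A ⟶ B) (g : B ⟶ D) (x : M.obj.obj A) :
    M.obj.map (f ≫ g) x = M.obj.map g (M.obj.map f x) :=
  ConcreteCategory.congr_hom (M.obj.map_comp f g) x

lemma map_id_apply (M : Mod C) {A : C} (x : M.obj.obj A) : M.obj.map (𝟙 A) x = x :=
  ConcreteCategory.congr_hom (M.obj.map_id A) x

lemma map_add_apply (M : Mod C) {A B : C} (f g : A ⟶ B) (x : M.obj.obj A) :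
    M.obj.map (f + g) x = M.obj.map f x + M.obj.map g x :=
  ConcreteCategory.congr_hom (M.obj.map_add (f := f) (g := g)) x

lemma map_zero_apply (M : Mod C) {A B : C} (x : M.obj.obj A) :
    M.obj.map (0 : A ⟶ B) x = 0 :=
  ConcreteCategory.congr_hom (M.obj.map_zero A B) x

/-- The morphism `Hom_C(A, -) ⟶ M` corresponding to an element of `M(A)`. -/
def yon {M : Mod C} {A : C} (x : M.obj.obj A) : rep A ⟶ M :=
  ObjectProperty.homMk
    { app := fun B => AddCommGrpCat.ofHom
        { toFun := fun f : A ⟶ B => M.obj.map f x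
          map_zero' := map_zero_apply M x
          map_add' := fun f g => map_add_apply M f g x }
      naturality := fun B D g => by
        refine ConcreteCategory.hom_ext _ _ fun f => ?_
        exact map_comp_apply M f g x }

/-- Morphisms out of `A`, as elements of the module `Hom_C(A, -)`. -/
def el {A B : C} : (A ⟶ B) ≃+ (rep A).obj.obj B := AddEquiv.refl _

@[simp]
lemma rep_map {A B D : C} (f : A ⟶ B) (g : B ⟶ D) : (rep A).obj.map g (el f) = el (f ≫ g) := rfl

@[simp]
lemma yon_app {M : Mod C} {A B : C} (x : M.obj.obj A) (f : A ⟶ B) :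
    (yon x).hom.app B (el f) = M.obj.map f x := rfl

/-- The element of `M(A)` corresponding to a morphism `Hom_C(A, -) ⟶ M`. -/
def elt {M : Mod C} {A : C} (φ : rep A ⟶ M) : M.obj.obj A := φ.hom.app A (el (𝟙 A))

@[simp]
lemma elt_yon {M : Mod C} {A : C} (x : M.obj.obj A) : elt (yon x) = x := map_id_apply M x

lemma app_el {M : Mod C} {A B : C} (φ : rep A ⟶ M) (f : A ⟶ B) :
    φ.hom.app B (el f) = M.obj.map f (elt φ) := by
  have h := app_map φ f (el (𝟙 A))
  rw [rep_map, Category.id_comp] at h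
  exact h

lemma rep_hom_ext {M : Mod C} {A : C} {φ ψ : rep A ⟶ M}
    (h : ∀ B (f : A ⟶ B), φ.hom.app B (el f) = ψ.hom.app B (el f)) : φ = ψ :=
  Mod.hom_ext' fun B f => h B (el.symm f)

@[simp]
lemma yon_elt {M : Mod C} {A : C} (φ : rep A ⟶ M) : yon (elt φ) = φ :=
  rep_hom_ext fun _ f => (app_el φ f).symm

lemma yon_comp {M N : Mod C} {A : C} (x : M.obj.obj A) (φ : M ⟶ N) :
    yon x ≫ φ = yon (φ.hom.app A x) :=
  Mod.hom_ext' fun _ f => app_map φ f x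

lemma yon_injective {M : Mod C} {A : C} {x y : M.obj.obj A} (h : yon x = yon y) : x = y := by
  rw [← elt_yon x, h, elt_yon]

@[simp]
lemma yon_zero {M : Mod C} {A : C} : yon (0 : M.obj.obj A) = 0 :=
  Mod.hom_ext' fun _ f => map_zero (M.obj.map f).hom

/-- Evaluation of modules at an object. -/
abbrev ev (A : C) : Mod C ⥤ AddCommGrpCat.{u} :=
  AdditiveFunctor.forget C AddCommGrpCat.{u} ⋙ (evaluation C AddCommGrpCat.{u}).obj A

instance (A : C) : PreservesFiniteLimits (ev A) where
  preservesFiniteLimits _ _ _ := inferInstance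

instance (A : C) : PreservesFiniteColimits (ev A) where
  preservesFiniteColimits _ _ _ := inferInstance

lemma exact_iff (S : ShortComplex (Mod C)) : S.Exact ↔
    ∀ (A : C) (x : S.X₂.obj.obj A), S.g.hom.app A x = 0 → ∃ y, S.f.hom.app A y = x := by
  constructor
  · intro h A
    have := h.map (ev A)
    rw [ShortComplex.ab_exact_iff] at this
    exact this
  · intro h
    rw [ShortComplex.exact_iff_isZero_homology]
    rw [IsZero.iff_id_eq_zero]
    refine Mod.hom_ext' fun A x => ?_
    have h1 : (S.map (ev A)).Exact := by
      rw [ShortComplex.ab_exact_iff]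
      exact h A
    rw [ShortComplex.exact_iff_isZero_homology] at h1
    have h2 : IsZero ((ev A).obj S.homology) := h1.of_iso (S.mapHomologyIso (ev A)).symm
    have := AddCommGrpCat.subsingleton_of_isZero h2
    exact @Subsingleton.elim _ this _ _

lemma mono_iff {M N : Mod C} (φ : M ⟶ N) :
    Mono φ ↔ ∀ A (x : M.obj.obj A), φ.hom.app A x = 0 → x = 0 := by
  constructor
  · intro _ A x hx
    apply yon_injective
    rw [← cancel_mono φ, yon_comp, hx]
    simp
  · intro h
    refine Preadditive.mono_of_cancel_zero _ fun g hg => Mod.hom_ext' fun A x => ?_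
    refine h A _ ?_
    rw [← comp_app, hg, zero_app]

lemma app_injective {M N : Mod C} (φ : M ⟶ N) [Mono φ] {A : C} {x y : M.obj.obj A}
    (h : φ.hom.app A x = φ.hom.app A y) : x = y := by
  apply yon_injective
  rw [← cancel_mono φ, yon_comp, yon_comp, h]

lemma epi_iff {M N : Mod C} (φ : M ⟶ N) :
    Epi φ ↔ ∀ A (x : N.obj.obj A), ∃ y, φ.hom.app A y = x := by
  constructor
  · intro _ A
    have : Epi ((ev A).map φ) := inferInstance
    rw [AddCommGrpCat.epi_iff_surjective] at this
    exact this
  · intro h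
    refine Preadditive.epi_of_cancel_zero _ fun g hg => Mod.hom_ext' fun A x => ?_
    obtain ⟨y, rfl⟩ := h A x
    rw [← comp_app, hg, zero_app, zero_app]

instance projective_rep (A : C) : Projective (rep A) where
  factors {E X} f e he := by
    obtain ⟨y, hy⟩ := (epi_iff e).1 he A (elt f)
    refine ⟨yon y, ?_⟩
    rw [yon_comp, hy, yon_elt]

/-- A morphism landing pointwise in the image of a monomorphism lifts along it. -/
lemma exists_lift_of_mono {M N K : Mod C} (i : M ⟶ N) [Mono i] (φ : K ⟶ N)
    (h : ∀ A (x : K.obj.obj A), ∃ y, i.hom.app A y = φ.hom.app A x) : ∃ ψ : K ⟶ M, ψ ≫ i = φ := by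
  refine ⟨Abelian.monoLift i φ ?_, Abelian.monoLift_comp i φ _⟩
  refine Mod.hom_ext' fun A x => ?_
  obtain ⟨y, hy⟩ := h A x
  rw [comp_app, ← hy, ← comp_app, cokernel.condition]
  rfl

end Pointwise

/-! ### Finitely presented modules -/

section FinPres

variable {C : Type u} [SmallCategory C] [Preadditive C]

/-- By Yoneda, a presentation amounts to a generator m whose relations all factor through one
morphism u. -/
lemma isFinPres_iff (M : Mod C) : IsFinPres M ↔
    ∃ (C₀ C₁ : C) (u : C₁ ⟶ C₀) (m : M.obj.obj C₁), M.obj.map u m = 0 ∧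
      (∀ A (x : M.obj.obj A), ∃ f : C₁ ⟶ A, M.obj.map f m = x) ∧
      ∀ A (f : C₁ ⟶ A), M.obj.map f m = 0 → ∃ h : C₀ ⟶ A, u ≫ h = f := by
  constructor
  · rintro ⟨C₀, C₁, f, p, w, h, hp⟩
    rw [exact_iff] at h
    rw [epi_iff] at hp
    dsimp at h
    obtain ⟨u, hu⟩ := el.surjective (elt f)
    refine ⟨C₀, C₁, u, elt p, ?_, fun A x => ?_, fun A g hg => ?_⟩
    · rw [← app_el, hu, elt, ← comp_app, w, zero_app]
    · obtain ⟨y, hy⟩ := hp A x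
      obtain ⟨g, rfl⟩ := el.surjective y
      exact ⟨g, by rw [← hy, app_el]⟩
    · obtain ⟨y, hy⟩ := h A (el g) (by rw [app_el, hg])
      obtain ⟨k, rfl⟩ := el.surjective y
      refine ⟨k, el.injective ?_⟩
      rw [← hy, app_el, ← hu, rep_map]
  · rintro ⟨C₀, C₁, u, m, hu, hm, hr⟩
    have w : yon (el u) ≫ yon m = 0 := by
      rw [yon_comp, yon_app, hu, yon_zero]
    refine ⟨C₀, C₁, yon (el u), yon m, w, (exact_iff _).2 fun A f hf => ?_,
      (epi_iff _).2 fun A x => ?_⟩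
    · dsimp at f hf
      obtain ⟨f, rfl⟩ := el.surjective f
      rw [yon_app] at hf
      obtain ⟨h, rfl⟩ := hr A f hf
      exact ⟨el h, rfl⟩
    · obtain ⟨f, rfl⟩ := hm A x
      exact ⟨el f, rfl⟩

lemma isFinPres_rep (A : C) : IsFinPres (rep A) := by
  rw [isFinPres_iff]
  refine ⟨A, A, 0, el (𝟙 A), ?_, fun B f => ?_, fun B f hf => ⟨0, ?_⟩⟩
  · rw [rep_map, comp_zero, map_zero]
  · obtain ⟨f, rfl⟩ := el.surjective f
    exact ⟨f, by rw [rep_map, Category.id_comp]⟩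
  · rw [rep_map, Category.id_comp, map_eq_zero_iff _ el.injective] at hf
    rw [hf, comp_zero]

lemma IsFinPres.exists_generator {M : Mod C} (hM : IsFinPres M) :
    ∃ (A : C) (p : rep A ⟶ M), Epi p := by
  obtain ⟨_, A, _, p, _, _, hp⟩ := hM
  exact ⟨A, p, hp⟩

lemma biproduct_app_eq_zero {n : ℕ} {M : Mod C} {A : C} {x : (⨁ fun _ : Fin n => M).obj.obj A}
    (h : ∀ i, (biproduct.π (fun _ : Fin n => M) i).hom.app A x = 0) : x = 0 := by
  apply yon_injective
  refine biproduct.hom_ext _ _ fun i => ?_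
  rw [yon_comp, yon_comp, h i, map_zero]

/-- Injectivity is tested by maps from representables, which already lie in mod(C). -/
lemma FpMod.mono_iff {M N : FpMod C} (f : M ⟶ N) : Mono f ↔ Mono f.hom := by
  constructor
  · intro _
    rw [RMod.mono_iff]
    intro A x hx
    apply yon_injective
    let g₁ : (⟨rep A, isFinPres_rep A⟩ : FpMod C) ⟶ M := ObjectProperty.homMk (yon x)
    let g₂ : (⟨rep A, isFinPres_rep A⟩ : FpMod C) ⟶ M := ObjectProperty.homMk (yon 0)
    have : g₁ = g₂ := by
      rw [← cancel_mono f]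
      apply ObjectProperty.hom_ext
      change yon x ≫ f.hom = yon 0 ≫ f.hom
      rw [yon_comp, yon_comp, hx, map_zero]
    exact congrArg (fun g => g.hom) this
  · intro _
    exact (IsFinPres (C := C)).ι.mono_of_mono_map ‹_›

variable [HasFiniteBiproducts C]

/-- A cokernel of a morphism from a finitely generated module to a finitely presented one is
finitely presented. -/
lemma isFinPres_of_exact {G M N : Mod C} {A : C} (q : rep A ⟶ G) [Epi q] (hM : IsFinPres M)
    (f : G ⟶ M) (p : M ⟶ N) [Epi p]
    (h : ∀ B (x : M.obj.obj B), p.hom.app B x = 0 ↔ ∃ y, f.hom.app B y = x) : IsFinPres N := by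
  have : HasBinaryBiproducts C := hasBinaryBiproducts_of_finite_biproducts C
  rw [isFinPres_iff] at hM ⊢
  obtain ⟨D₀, D₁, v, b, hv, hb, hr⟩ := hM
  obtain ⟨w, hw⟩ := hb A (f.hom.app A (elt q))
  -- The relations of N are those of M, given by v, and the image of the generator of G, lifted to
  -- w.
  refine ⟨D₀ ⊞ A, D₁, biprod.lift v w, p.hom.app D₁ b, ?_, fun B x => ?_, fun B g hg => ?_⟩
  · have : biprod.lift v w = v ≫ biprod.inl + w ≫ biprod.inr := by
      ext <;> simp
    rw [this, map_add_apply, map_comp_apply, map_comp_apply, ← app_map p v, ← app_map p w, hv, hw,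
      (h _ _).2 ⟨_, rfl⟩]
    simp
  · obtain ⟨y, rfl⟩ := (epi_iff p).1 inferInstance B x
    obtain ⟨g, rfl⟩ := hb B y
    exact ⟨g, (app_map p g b).symm⟩
  · rw [← app_map, h] at hg
    obtain ⟨y, hy⟩ := hg
    obtain ⟨k, rfl⟩ := (epi_iff q).1 inferInstance B y
    obtain ⟨k, rfl⟩ := el.surjective k
    rw [app_el, app_map, ← hw, ← map_comp_apply] at hy
    obtain ⟨l, hl⟩ := hr B (g - w ≫ k) (by
      have := map_add_apply M (g - w ≫ k) (w ≫ k) b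
      rw [sub_add_cancel, hy] at this
      simpa using this)
    exact ⟨biprod.desc l k, by simp [hl]⟩

lemma isFinPres_cokernel {M N : Mod C} (hM : IsFinPres M) (hN : IsFinPres N) (f : M ⟶ N) :
    IsFinPres (cokernel f) := by
  obtain ⟨A, q, hq⟩ := hM.exists_generator
  refine isFinPres_of_exact q hN f (cokernel.π f) fun B x => ⟨fun hx => ?_, ?_⟩
  · exact (exact_iff (ShortComplex.mk f (cokernel.π f) (cokernel.condition f))).1
      (ShortComplex.exact_cokernel f) B x hx
  · rintro ⟨y, rfl⟩
    rw [← comp_app, cokernel.condition, zero_app]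

lemma isFinPres_biproduct {M : Mod C} (hM : IsFinPres M) (n : ℕ) :
    IsFinPres (⨁ fun _ : Fin n => M) := by
  rw [isFinPres_iff] at hM ⊢
  obtain ⟨C₀, C₁, u, m, hu, hm, hr⟩ := hM
  let φ : rep (⨁ fun _ : Fin n => C₁) ⟶ ⨁ fun _ : Fin n => M :=
    biproduct.lift fun i => yon (M.obj.map (biproduct.ι (fun _ : Fin n => C₁) i) m)
  have hφ : ∀ B (f : (⨁ fun _ : Fin n => C₁) ⟶ B) i,
      (biproduct.π (fun _ : Fin n => M) i).hom.app B ((⨁ fun _ : Fin n => M).obj.map f (elt φ)) =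
        M.obj.map (biproduct.ι (fun _ : Fin n => C₁) i ≫ f) m := fun B f i => by
    rw [← app_el, ← comp_app, biproduct.lift_π, yon_app, map_comp_apply]
  refine ⟨⨁ fun _ : Fin n => C₀, _, biproduct.map fun _ => u, elt φ, ?_, fun B x => ?_,
    fun B f hf => ?_⟩
  · refine biproduct_app_eq_zero fun i => ?_
    rw [hφ, biproduct.ι_map, map_comp_apply, hu, map_zero]
  · choose f hf using fun i => hm B ((biproduct.π (fun _ : Fin n => M) i).hom.app B x)
    refine ⟨biproduct.desc f, ?_⟩
    rw [← sub_eq_zero]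
    refine biproduct_app_eq_zero fun i => ?_
    rw [map_sub, hφ, biproduct.ι_desc, hf, sub_self]
  · choose h hh using fun i => hr B (biproduct.ι (fun _ : Fin n => C₁) i ≫ f)
      (by rw [← hφ, hf, map_zero])
    refine ⟨biproduct.desc h, ?_⟩
    ext i
    simp [hh]

lemma FpMod.epi_iff {M N : FpMod C} (f : M ⟶ N) : Epi f ↔ Epi f.hom := by
  constructor
  · intro _
    refine Preadditive.epi_of_isZero_cokernel _ ((IsZero.iff_id_eq_zero _).2 ?_)
    rw [← cancel_epi (cokernel.π f.hom), comp_zero, Category.comp_id]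
    let g₁ : N ⟶ (⟨_, isFinPres_cokernel M.property N.property f.hom⟩ : FpMod C) :=
      ObjectProperty.homMk (cokernel.π f.hom)
    let g₂ : N ⟶ (⟨_, isFinPres_cokernel M.property N.property f.hom⟩ : FpMod C) :=
      ObjectProperty.homMk 0
    have : g₁ = g₂ := by
      rw [← cancel_epi f]
      apply ObjectProperty.hom_ext
      change f.hom ≫ cokernel.π f.hom = f.hom ≫ 0
      rw [cokernel.condition, comp_zero]
    exact congrArg (fun g => g.hom) this
  · intro _
    exact (IsFinPres (C := C)).ι.epi_of_epi_map ‹_›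

end FinPres

/-- The linear structure on the opposite category. -/
abbrev linearOpposite (R : Type u) [CommRing R] (C : Type u) [SmallCategory C] [Preadditive C]
    [Linear R C] : Linear R Cᵒᵖ where
  homModule X Y :=
    { smul := fun r f => (r • f.unop).op
      one_smul := fun f => congrArg Quiver.Hom.op (one_smul R f.unop)
      mul_smul := fun r s f => congrArg Quiver.Hom.op (mul_smul r s f.unop)
      smul_zero := fun r => congrArg Quiver.Hom.op (smul_zero (A := Y.unop ⟶ X.unop) r)
      smul_add := fun r f g => congrArg Quiver.Hom.op (smul_add r f.unop g.unop)
      add_smul := fun r s f => congrArg Quiver.Hom.op (add_smul r s f.unop)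
      zero_smul := fun f => congrArg Quiver.Hom.op (zero_smul R f.unop) }
  smul_comp _ _ _ r f g := congrArg Quiver.Hom.op (Linear.comp_smul _ _ _ g.unop r f.unop)
  comp_smul _ _ _ f r g := congrArg Quiver.Hom.op (Linear.smul_comp _ _ _ r g.unop f.unop)

lemma hasFiniteBiproducts_op (C : Type u) [SmallCategory C] [Preadditive C]
    [HasFiniteBiproducts C] : HasFiniteBiproducts Cᵒᵖ :=
  have : HasFiniteCoproducts C := inferInstance
  have : HasFiniteProducts Cᵒᵖ := inferInstance
  HasFiniteBiproducts.of_hasFiniteProducts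

/-! ### Kernels in mod(C) from the duality -/

section Duality

variable {C : Type u} [SmallCategory C] [Preadditive C] [HasFiniteBiproducts C]

/-- `Hom_C(A, -)` as a finitely presented module. -/
abbrev fpRep (A : C) : FpMod C := ⟨rep A, isFinPres_rep A⟩

/-- The kernel is dual to the cokernel of the dual morphism. Its universal property, tested on
representables, makes it the pointwise kernel. -/
lemma exists_kernel (Φ : (FpMod C)ᵒᵖ ⥤ FpMod Cᵒᵖ) [Φ.IsEquivalence] {M N : FpMod C} (f : M ⟶ N) :
    ∃ (K : FpMod C) (k : K ⟶ M), Mono k.hom ∧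
      ∀ A (x : M.obj.obj.obj A), f.hom.hom.app A x = 0 ↔ ∃ y, k.hom.hom.app A y = x := by
  have := hasFiniteBiproducts_op C
  let g := Φ.map f.op
  let Q : FpMod Cᵒᵖ := ⟨_, isFinPres_cokernel (Φ.obj (op N)).property (Φ.obj (op M)).property g.hom⟩
  let q : Φ.obj (op M) ⟶ Q := ObjectProperty.homMk (cokernel.π g.hom)
  have hq : Epi q := (FpMod.epi_iff q).2 (inferInstanceAs (Epi (cokernel.π g.hom)))
  have hgq : g ≫ q = 0 := ObjectProperty.hom_ext _ (cokernel.condition g.hom)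
  let e : Φ.obj (Φ.objPreimage Q) ≅ Q := Φ.objObjPreimageIso Q
  let k : (Φ.objPreimage Q).unop ⟶ M := (Φ.preimage (q ≫ e.inv)).unop
  have hk : Φ.map k.op = q ≫ e.inv := Φ.map_preimage _
  have hkf : k ≫ f = 0 := by
    apply Quiver.Hom.op_inj
    apply Φ.map_injective
    rw [op_comp, Φ.map_comp, hk, reassoc_of% hgq, op_zero, Φ.map_zero, zero_comp]
  have hmono : Mono k := by
    have : Epi (Φ.map k.op) := by rw [hk]; infer_instance
    have : Epi k.op := Φ.epi_of_epi_map this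
    exact unop_mono_of_epi k.op
  refine ⟨_, k, (FpMod.mono_iff k).1 hmono, fun A x => ⟨fun hx => ?_, ?_⟩⟩
  · let t : fpRep A ⟶ M := ObjectProperty.homMk (yon x)
    have htf : t ≫ f = 0 := by
      apply ObjectProperty.hom_ext
      change yon x ≫ f.hom = 0
      rw [yon_comp, hx, yon_zero]
    have hgt : g ≫ Φ.map t.op = 0 := by
      rw [← Φ.map_comp, ← op_comp, htf, op_zero, Φ.map_zero]
    let d : Q ⟶ Φ.obj (op (fpRep A)) := ObjectProperty.homMk (cokernel.desc g.hom (Φ.map t.op).hom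
      (congrArg (fun a => a.hom) hgt))
    have hd : q ≫ d = Φ.map t.op := ObjectProperty.hom_ext _ (cokernel.π_desc _ _ _)
    let l : fpRep A ⟶ (Φ.objPreimage Q).unop := (Φ.preimage (e.hom ≫ d)).unop
    have hl : l ≫ k = t := by
      apply Quiver.Hom.op_inj
      apply Φ.map_injective
      rw [op_comp, Φ.map_comp, hk, Quiver.Hom.op_unop, Φ.map_preimage, Category.assoc,
        e.inv_hom_id_assoc, hd]
    refine ⟨elt l.hom, ?_⟩
    rw [elt, ← comp_app]
    change elt (l ≫ k).hom = x
    rw [hl]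
    exact elt_yon x
  · rintro ⟨y, rfl⟩
    rw [← comp_app]
    change (k ≫ f).hom.hom.app A y = 0
    rw [hkf]
    rfl

end Duality

/-! ### Fitting's lemma and projective covers -/

section ProjectiveCover

variable {D : Type u} [SmallCategory D] [Preadditive D] (R : Type u) [CommRing R] [Linear R D]

/-- Fitting's lemma for an endomorphism in a linear category. -/
lemma exists_fitting [IsArtinianRing R] {Y : D} [Module.Finite R (Y ⟶ Y)] (u : Y ⟶ Y)
    {N : Mod D} (n : N.obj.obj Y) (hn : N.obj.map u n = n) :
    ∃ f : Y ⟶ Y, f ≫ f = f ∧ N.obj.map f n = n ∧ (f = 𝟙 Y → ∃ v, u ≫ v = 𝟙 Y) := by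
  let T : (Y ⟶ Y) →ₗ[R] (Y ⟶ Y) := Linear.leftComp R Y u
  have hT : ∀ k c, (T ^ k) c = (T ^ k) (𝟙 Y) ≫ c := by
    intro k
    induction k with
    | zero => simp
    | succ k ih =>
      intro c
      rw [pow_succ', Module.End.mul_apply, Module.End.mul_apply, ih]
      simp [T]
  have hTn : ∀ k, N.obj.map ((T ^ k) (𝟙 Y)) n = n := by
    intro k
    induction k with
    | zero => exact map_id_apply N n
    | succ k ih =>
      rw [pow_succ', Module.End.mul_apply]
      change N.obj.map (u ≫ (T ^ k) (𝟙 Y)) n = n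
      rw [map_comp_apply, hn, ih]
  -- `T ^ k` is composition with u^k, and f is the component of the identity in its range. The bound
  -- k ≥ 1 lets one factor u be split off at the end.
  obtain ⟨k, hk, hk1⟩ := (T.eventually_isCompl_ker_pow_range_pow.and
    (Filter.eventually_ge_atTop 1)).exists
  set w := (T ^ k) (𝟙 Y) with hw
  obtain ⟨f', hf', f, hf, hff⟩ := Submodule.mem_sup.1
    (hk.codisjoint.eq_top.symm ▸ Submodule.mem_top : (𝟙 Y) ∈ LinearMap.ker (T ^ k) ⊔ LinearMap.range (T ^ k))
  obtain ⟨b, hb⟩ := hf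
  rw [LinearMap.mem_ker, hT, ← hw] at hf'
  rw [hT, ← hw] at hb
  have hwf : w ≫ f = w := by
    have : w ≫ (f' + f) = w := by rw [hff, Category.comp_id]
    rwa [Preadditive.comp_add, hf', zero_add] at this
  have hf'' : f' = 𝟙 Y - f := by rw [← hff, add_sub_cancel_right]
  have h0 : f' ≫ f = 0 := by
    have h1 : f' ≫ f ∈ LinearMap.ker (T ^ k) := by
      rw [LinearMap.mem_ker, hT, ← hw, reassoc_of% hf', zero_comp]
    have h2 : f' ≫ f ∈ LinearMap.range (T ^ k) := by
      refine ⟨b - b ≫ f, ?_⟩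
      rw [hT, ← hw, hf'', Preadditive.comp_sub, reassoc_of% hb, hb]
      simp
    exact (Submodule.mem_bot R).1 (hk.disjoint.eq_bot ▸ ⟨h1, h2⟩)
  refine ⟨f, ?_, ?_, fun h => ?_⟩
  · rw [hf'', Preadditive.sub_comp, Category.id_comp, sub_eq_zero] at h0
    exact h0.symm
  · have := hTn k
    rw [← hw] at this
    rw [← this, ← map_comp_apply, hwf]
  · obtain ⟨l, rfl⟩ : ∃ l, k = l + 1 := ⟨k - 1, by omega⟩
    refine ⟨(T ^ l) (𝟙 Y) ≫ b, ?_⟩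
    have hwl : w = u ≫ (T ^ l) (𝟙 Y) := by
      rw [hw, pow_succ', Module.End.mul_apply]
      rfl
    rw [← Category.assoc, ← hwl, hb, h]

/-- Existence of projective covers by representable modules. -/
lemma exists_projectiveCover [IsArtinianRing R] [IsIdempotentComplete D]
    (hfin : ∀ Y : D, Module.Finite R (Y ⟶ Y)) {N : Mod D} {Y₀ : D} (q₀ : rep Y₀ ⟶ N) [Epi q₀] :
    ∃ (Y : D) (q : rep Y ⟶ N), Epi q ∧
      ∀ {T : Mod D} (g : T ⟶ rep Y), Epi (g ≫ q) → Epi g := by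
  let s : Set D := {Y | ∃ q : rep Y ⟶ N, Epi q}
  -- Minimal length of End Y replaces minimality of Y: splitting a nontrivial idempotent that fixes
  -- the generator would yield a generating object with a shorter endomorphism ring.
  obtain ⟨Y, ⟨q, hq⟩, hmin⟩ := exists_minimalFor_of_wellFoundedLT (· ∈ s)
    (fun Y : D => Module.length R (Y ⟶ Y)) ⟨Y₀, q₀, inferInstance⟩
  refine ⟨Y, q, hq, fun {T} g hg => ?_⟩
  let h : rep Y ⟶ T := Projective.factorThru q (g ≫ q)
  have hh : (h ≫ g) ≫ q = q := by rw [Category.assoc, Projective.factorThru_comp]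
  obtain ⟨u, hu⟩ := el.surjective (elt (h ≫ g))
  have hun : N.obj.map u (elt q) = elt q := by
    rw [← app_el, hu]
    exact congrArg elt hh
  obtain ⟨f, hf, hfn, hf1⟩ := exists_fitting R u (elt q) hun
  by_cases hf' : f = 𝟙 Y
  · obtain ⟨v, hv⟩ := hf1 hf'
    rw [epi_iff]
    intro B y
    obtain ⟨y, rfl⟩ := el.surjective y
    refine ⟨h.hom.app B (el (v ≫ y)), ?_⟩
    rw [← comp_app, app_el, ← hu, rep_map, reassoc_of% hv]
  · exfalso
    obtain ⟨Y₁, j, p, hjp, hpj⟩ := IsIdempotentComplete.idempotents_split Y f hf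
    have hs : Y₁ ∈ s := by
      refine ⟨yon (N.obj.map p (elt q)), (epi_iff _).2 fun B x => ?_⟩
      obtain ⟨y, rfl⟩ := (epi_iff q).1 hq B x
      obtain ⟨y, rfl⟩ := el.surjective y
      refine ⟨el (j ≫ y), ?_⟩
      rw [yon_app, ← map_comp_apply, reassoc_of% hpj, map_comp_apply, hfn, app_el]
    let L : (Y₁ ⟶ Y₁) →ₗ[R] (Y ⟶ Y) := Linear.rightComp R Y j ∘ₗ Linear.leftComp R Y₁ p
    have hL : ∀ v, L v = p ≫ v ≫ j := fun v => by simp [L]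
    have hLinj : Function.Injective L := fun v v' hvv => by
      rw [hL, hL] at hvv
      have := congrArg (fun a => j ≫ a ≫ p) hvv
      simpa [reassoc_of% hjp, hjp] using this
    have hlt : LinearMap.range L < ⊤ := by
      rw [lt_top_iff_ne_top]
      intro ht
      obtain ⟨v, hv⟩ : 𝟙 Y ∈ LinearMap.range L := ht ▸ Submodule.mem_top
      rw [hL] at hv
      apply hf'
      rw [← Category.comp_id f, ← hv, ← hpj, Category.assoc, reassoc_of% hjp, hv]
    have := Submodule.length_lt (R := R) hlt.ne
    rw [← (LinearEquiv.ofInjective L hLinj).length_eq] at this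
    exact absurd (hmin hs this.le) (not_le.2 this)

end ProjectiveCover

/-! ### Cogenerators over artinian rings -/

section Artinian

/-- Over an artinian ring, a proper left ideal is carried into the radical by right multiplication
with some element outside of the radical. -/
lemma exists_mul_mem_jacobson {Λ : Type*} [Ring Λ] [IsArtinianRing Λ] {L : Ideal Λ} (hL : L ≠ ⊤) :
    ∃ a, a ∉ Ring.jacobson Λ ∧ ∀ x ∈ L, x * a ∈ Ring.jacobson Λ := by
  obtain ⟨m, hm, hLm⟩ := Ideal.exists_le_maximal L hL
  have hjm : Ring.jacobson Λ ≤ m := by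
    rw [← Ideal.jacobson_bot]
    exact sInf_le ⟨bot_le, hm⟩
  have : IsSemisimpleModule Λ (Λ ⧸ Ring.jacobson Λ) :=
    (IsArtinian.isSemisimpleModule_iff_jacobson Λ _).2 (Module.jacobson_quotient_jacobson Λ Λ)
  let p : Λ →ₗ[Λ] Λ ⧸ Ring.jacobson Λ := (Ring.jacobson Λ).mkQ
  have hp : ∀ x, p x = 0 ↔ x ∈ Ring.jacobson Λ := fun x => Submodule.Quotient.mk_eq_zero _
  -- The ring modulo its radical is semisimple, so m has a complement c there. With a the component
  -- of 1 in c, right multiplication by a sends L into both c and m modulo the radical.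
  obtain ⟨c, hc⟩ := exists_isCompl (Submodule.map p m)
  obtain ⟨e', he', e, he, hee⟩ := Submodule.mem_sup.1
    (hc.codisjoint.eq_top.symm ▸ Submodule.mem_top : p 1 ∈ Submodule.map p m ⊔ c)
  obtain ⟨b, hb, rfl⟩ := he'
  obtain ⟨a, rfl⟩ := Submodule.mkQ_surjective _ e
  change p b + p a = p 1 at hee
  refine ⟨a, fun ha => ?_, fun x hx => ?_⟩
  · rw [(hp a).2 ha, add_zero, eq_comm, ← sub_eq_zero, ← map_sub, hp] at hee
    refine hm.ne_top ((Ideal.eq_top_iff_one m).2 ?_)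
    have := m.add_mem (hjm hee) hb
    rwa [sub_add_cancel] at this
  · rw [← hp]
    have h1 : p (x * a) ∈ c := by
      have := c.smul_mem x he
      rwa [← smul_eq_mul, map_smul]
    have h2 : p (x * a) ∈ Submodule.map p m := by
      have : p (x * a) = p (x - x * b) := by
        have h3 : p (x * a) + p (x * b) = p x := by
          rw [← smul_eq_mul, ← smul_eq_mul, map_smul, map_smul, ← smul_add, add_comm, hee,
            ← map_smul, smul_eq_mul, mul_one]
        rw [map_sub, ← h3, add_sub_cancel_right]
      rw [this]
      exact Submodule.mem_map_of_mem (m.sub_mem (hLm hx) (m.mul_mem_left x hb))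
    exact (Submodule.mem_bot Λ).1 (hc.disjoint.eq_bot ▸ ⟨h2, h1⟩)

/-- An injective envelope of `R / rad R` is a cogenerator. -/
lemma exists_functional {R : Type u} [CommRing R] [IsArtinianRing R] {E : ModuleCat.{u} R}
    {i : ModuleCat.of R (R ⧸ Ring.jacobson R) ⟶ E} (hi : IsInjectiveEnvelope i)
    {V : ModuleCat.{u} R} (W : Submodule R V) {v : V} (hv : v ∉ W) :
    ∃ φ : V ⟶ E, (∀ w ∈ W, φ w = 0) ∧ φ v ≠ 0 := by
  let q : V →ₗ[R] V ⧸ W := W.mkQ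
  let t : R →ₗ[R] V ⧸ W := LinearMap.toSpanSingleton R _ (q v)
  have hker : LinearMap.ker t ≠ ⊤ := by
    intro h
    have : (1 : R) ∈ LinearMap.ker t := h ▸ Submodule.mem_top
    rw [LinearMap.mem_ker, LinearMap.toSpanSingleton_apply, one_smul] at this
    exact hv ((Submodule.Quotient.mk_eq_zero W).1 this)
  obtain ⟨a, ha, haL⟩ := exists_mul_mem_jacobson hker
  let s : ModuleCat.of R (R ⧸ LinearMap.ker t) ⟶ ModuleCat.of R (V ⧸ W) :=
    ModuleCat.ofHom ((LinearMap.ker t).liftQ t le_rfl)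
  let r : ModuleCat.of R (R ⧸ LinearMap.ker t) ⟶ ModuleCat.of R (R ⧸ Ring.jacobson R) :=
    ModuleCat.ofHom ((LinearMap.ker t).liftQ
      (LinearMap.toSpanSingleton R _ (Submodule.Quotient.mk a)) fun x hx => by
        rw [LinearMap.mem_ker, LinearMap.toSpanSingleton_apply, ← Submodule.Quotient.mk_smul,
          Submodule.Quotient.mk_eq_zero]
        exact haL x hx)
  have hs : Mono s := by
    rw [ModuleCat.mono_iff_injective]
    exact LinearMap.ker_eq_bot.1 (Submodule.ker_liftQ_eq_bot _ _ _ le_rfl)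
  have := hi.injective
  have hi' := hi.mono
  rw [ModuleCat.mono_iff_injective] at hi'
  let φ := Injective.factorThru (r ≫ i) s
  have hφ : s ≫ φ = r ≫ i := Injective.comp_factorThru _ _
  refine ⟨ModuleCat.ofHom q ≫ φ, fun w hw => ?_, fun h => ha ?_⟩
  · rw [ConcreteCategory.comp_apply]
    have : (ModuleCat.ofHom q) w = 0 := (Submodule.Quotient.mk_eq_zero W).2 hw
    rw [this, map_zero]
  · have h1 : s (Submodule.Quotient.mk 1) = (ModuleCat.ofHom q) v := one_smul R (q v)
    have h2 : r (Submodule.Quotient.mk 1) = Submodule.Quotient.mk a :=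
      one_smul R (Submodule.Quotient.mk a : R ⧸ Ring.jacobson R)
    rw [ConcreteCategory.comp_apply, ← h1, ← ConcreteCategory.comp_apply, hφ,
      ConcreteCategory.comp_apply, h2] at h
    rw [← Submodule.Quotient.mk_eq_zero (Ring.jacobson R)]
    exact hi' (h.trans (map_zero i.hom).symm)

end Artinian

/-! ### Injective objects of mod(C) -/

section Injectives

lemma projective_fpRep {D : Type u} [SmallCategory D] [Preadditive D] [HasFiniteBiproducts D]
    (A : D) : Projective (fpRep A) where
  factors {E X} f e he := by
    have := (FpMod.epi_iff e).1 he
    exact ⟨ObjectProperty.homMk (Projective.factorThru f.hom e.hom),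
      ObjectProperty.hom_ext _ (Projective.factorThru_comp f.hom e.hom)⟩

variable {C : Type u} [SmallCategory C] [Preadditive C]

/-- The functor between categories of finitely presented modules induced by the duality. -/
abbrev fpDual (R : Type u) [CommRing R] [Linear R C] (E : ModuleCat.{u} R)
    (h : ∀ M : Mod C, IsFinPres M → IsFinPres ((dual R E).obj (op M))) :
    (FpMod C)ᵒᵖ ⥤ FpMod Cᵒᵖ :=
  (IsFinPres (C := Cᵒᵖ)).lift ((IsFinPres (C := C)).ι.op ⋙ dual R E) fun M => h _ M.unop.property

/-- Linear functionals on `N(Y)` come from morphisms from `N` to a fixed module. -/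
lemma exists_dualRep {R : Type u} [CommRing R] [Linear R C] {E : ModuleCat.{u} R}
    (h : ∀ M : Mod C, IsFinPres M → IsFinPres ((dual R E).obj (op M)))
    [(fpDual R E h).IsEquivalence] (Y : C) :
    ∃ J : FpMod C, ∀ (N : FpMod C) (φ : ((toModuleCat R).obj N.obj).obj Y ⟶ E),
      ∃ ψ : N ⟶ J, ∀ (A : C) (x : N.obj.obj.obj A),
        ψ.hom.hom.app A x = 0 ↔ ∀ g : A ⟶ Y, φ (N.obj.obj.map g x) = 0 := by
  set Φ := fpDual R E h with hΦ
  let e : Φ.obj (Φ.objPreimage (fpRep (op Y))) ≅ fpRep (op Y) := Φ.objObjPreimageIso _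
  refine ⟨(Φ.objPreimage (fpRep (op Y))).unop, fun N φ => ?_⟩
  let φ' : ((dual R E).obj (op N.obj)).obj.obj (op Y) := φ
  -- By Yoneda, φ is a map from Hom(-, Y) to the dual of N; the module sought is the one whose dual
  -- is Hom(-, Y).
  let t : fpRep (op Y) ⟶ Φ.obj (op N) := ObjectProperty.homMk (yon φ')
  let ψ : N ⟶ (Φ.objPreimage (fpRep (op Y))).unop := (Φ.preimage (e.hom ≫ t)).unop
  have hψ : Φ.map ψ.op = e.hom ≫ t := Φ.map_preimage _
  refine ⟨ψ, fun A x => ?_⟩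
  let y : fpRep A ⟶ N := ObjectProperty.homMk (yon x)
  have h1 : ψ.hom.hom.app A x = 0 ↔ y ≫ ψ = 0 := by
    have : (y ≫ ψ).hom = yon (ψ.hom.hom.app A x) := yon_comp x ψ.hom
    constructor
    · intro h
      apply ObjectProperty.hom_ext
      rw [this, h, yon_zero]
      rfl
    · intro h
      rw [h] at this
      apply yon_injective
      rw [← this, yon_zero]
      rfl
  have h2 : y ≫ ψ = 0 ↔ t ≫ Φ.map y.op = 0 := by
    have h3 : Φ.map (y ≫ ψ).op = e.hom ≫ t ≫ Φ.map y.op := by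
      rw [op_comp, Φ.map_comp, hψ, Category.assoc]
    constructor
    · intro h
      rw [h, op_zero, Φ.map_zero] at h3
      rw [← cancel_epi e.hom, ← h3, comp_zero]
    · intro h
      rw [h, comp_zero] at h3
      apply Quiver.Hom.op_inj
      apply Φ.map_injective
      rw [h3, op_zero, Φ.map_zero]
  have h4 : (t ≫ Φ.map y.op).hom = yon (((dual R E).map (yon x).op).hom.app (op Y) φ') :=
    yon_comp φ' ((dual R E).map (yon x).op)
  have h5 : t ≫ Φ.map y.op = 0 ↔ ((dual R E).map (yon x).op).hom.app (op Y) φ' = 0 := by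
    constructor
    · intro h
      rw [h] at h4
      apply yon_injective
      rw [← h4, yon_zero]
      rfl
    · intro h
      apply ObjectProperty.hom_ext
      rw [h4, h, yon_zero]
      rfl
  rw [h1, h2, h5]
  constructor
  · intro h g
    have : ((toModuleCat R).map (yon x)).app Y ≫ φ = 0 := h
    exact ConcreteCategory.congr_hom this
      (show ((toModuleCat R).obj (rep A)).obj Y from (el g : (rep A).obj.obj Y))
  · intro h
    change ((toModuleCat R).map (yon x)).app Y ≫ φ = 0
    refine ConcreteCategory.hom_ext _ _ fun g => ?_
    exact h (el.symm g)

variable [HasFiniteBiproducts C]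

/-- The duality turns a projective cover of the dual of M into an injective envelope of M. -/
lemma exists_injectiveEnvelope (R : Type u) [CommRing R] [Linear R C] [IsArtinianRing R]
    [IsIdempotentComplete C] (hfin : ∀ Y : C, Module.Finite R (Y ⟶ Y))
    (Φ : (FpMod C)ᵒᵖ ⥤ FpMod Cᵒᵖ) [Φ.IsEquivalence] (M : FpMod C) :
    ∃ (J : FpMod C) (i : M ⟶ J), IsInjectiveEnvelope i := by
  have := hasFiniteBiproducts_op C
  let := linearOpposite R C
  have hfin' : ∀ Y : Cᵒᵖ, Module.Finite R (Y ⟶ Y) := fun Y =>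
    let s : (Y.unop ⟶ Y.unop) →ₗ[R] (Y ⟶ Y) :=
      { toFun := fun f => f.op, map_add' := fun _ _ => rfl, map_smul' := fun _ _ => rfl }
    Module.Finite.of_surjective s fun f => ⟨f.unop, rfl⟩
  obtain ⟨Y₀, q₀, hq₀⟩ := (Φ.obj (op M)).property.exists_generator
  obtain ⟨Y, q, hq, hess⟩ := exists_projectiveCover R hfin' q₀
  let e : Φ.obj (Φ.objPreimage (fpRep Y)) ≅ fpRep Y := Φ.objObjPreimageIso _
  let q' : fpRep Y ⟶ Φ.obj (op M) := ObjectProperty.homMk q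
  have hq' : Epi q' := (FpMod.epi_iff q').2 hq
  let i : M ⟶ (Φ.objPreimage (fpRep Y)).unop := (Φ.preimage (e.hom ≫ q')).unop
  have hi : Φ.map i.op = e.hom ≫ q' := Φ.map_preimage _
  refine ⟨_, i, ⟨?_, ?_, fun {T} g hg => ?_⟩⟩
  · have h1 : Projective (Φ.obj (Φ.objPreimage (fpRep Y))) :=
      Projective.of_iso e.symm (projective_fpRep Y)
    have h2 : Projective (Φ.objPreimage (fpRep Y)) :=
      (Φ.asEquivalence.map_projective_iff _).1 h1
    exact Injective.injective_iff_projective_op.2 h2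
  · have : Epi (Φ.map i.op) := by rw [hi]; infer_instance
    have : Epi i.op := Φ.epi_of_epi_map this
    exact unop_mono_of_epi i.op
  · have h1 : Epi (Φ.map (i ≫ g).op) := inferInstance
    rw [op_comp, Φ.map_comp, hi] at h1
    have h2 : Epi ((Φ.map g.op ≫ e.hom) ≫ q') := by rwa [Category.assoc]
    have h3 : Epi (Φ.map g.op ≫ e.hom) := by
      rw [FpMod.epi_iff]
      exact hess _ ((FpMod.epi_iff _).1 h2)
    have h4 : Epi (Φ.map g.op) := by
      have : Epi ((Φ.map g.op ≫ e.hom) ≫ e.inv) := inferInstance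
      simpa using this
    have : Epi g.op := Φ.epi_of_epi_map h4
    exact unop_mono_of_epi g.op

end Injectives

/-! ### Separation by morphisms, finite length and torsion free modules -/

section

variable {R : Type u} [CommRing R] {C : Type u} [SmallCategory C] [Preadditive C] [Linear R C]

lemma IsDualizingVariety.exists_kernel (hC : IsDualizingVariety R C) {M N : Mod C}
    (hM : IsFinPres M) (hN : IsFinPres N) (f : M ⟶ N) :
    ∃ (K : Mod C) (k : K ⟶ M), IsFinPres K ∧ Mono k ∧
      ∀ A (x : M.obj.obj A), f.hom.app A x = 0 ↔ ∃ y, k.hom.app A y = x := by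
  have := hC.hasFiniteBiproducts
  obtain ⟨E, i, hi, h, hΦ⟩ := hC.duality
  obtain ⟨K, k, hk, hk'⟩ := RMod.exists_kernel (fpDual R E h) (M := ⟨M, hM⟩) (N := ⟨N, hN⟩)
    (ObjectProperty.homMk f)
  exact ⟨K.obj, k.hom, K.property, hk, hk'⟩

lemma IsDualizingVariety.exists_injectiveEnvelope (hC : IsDualizingVariety R C) (M : FpMod C) :
    ∃ (J : FpMod C) (i : M ⟶ J), IsInjectiveEnvelope i := by
  have := hC.hasFiniteBiproducts
  have := hC.isArtinianRing
  have := hC.isIdempotentComplete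
  obtain ⟨E, i, hi, h, hΦ⟩ := hC.duality
  exact RMod.exists_injectiveEnvelope R (fun Y => hC.homFinite Y Y) (fpDual R E h) M

variable (R) in
/-- The value of a submodule at an object, as an `R`-submodule. -/
def Sub.submodule {M : Mod C} (W : Sub M) (Y : C) :
    Submodule R (((toModuleCat R).obj M).obj Y) where
  carrier := (W.carrier Y : Set (M.obj.obj Y))
  add_mem' := (W.carrier Y).add_mem
  zero_mem' := (W.carrier Y).zero_mem
  smul_mem' r _ hx := W.map_mem (r • 𝟙 Y) hx

/-- E is a cogenerator, so some functional on N(Y) kills W(Y) but not x; it comes from a morphism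
into the module of `exists_dualRep`. The submodule W need not be finitely presented. -/
lemma IsDualizingVariety.exists_separating (hC : IsDualizingVariety R C) (Y : C) :
    ∃ J : FpMod C, ∀ {N : Mod C} (_ : IsFinPres N) (W : Sub N) {x : N.obj.obj Y},
      x ∉ W.carrier Y → ∃ ψ : N ⟶ J.obj,
        (∀ A (w : N.obj.obj A), w ∈ W.carrier A → ψ.hom.app A w = 0) ∧ ψ.hom.app Y x ≠ 0 := by
  have := hC.isArtinianRing
  obtain ⟨E, i, hi, h, hΦ⟩ := hC.duality
  obtain ⟨J, hJ⟩ := exists_dualRep h Y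
  refine ⟨J, fun {N} hN W x hx => ?_⟩
  obtain ⟨φ, hφW, hφx⟩ := exists_functional hi (V := ((toModuleCat R).obj N).obj Y)
    (W.submodule R Y) (v := x) hx
  obtain ⟨ψ, hψ⟩ := hJ ⟨N, hN⟩ φ
  refine ⟨ψ.hom, fun A w hw => (hψ A w).2 fun g => hφW _ (W.map_mem g hw), fun h0 => hφx ?_⟩
  have := (hψ Y x).1 h0 (𝟙 Y)
  dsimp at this
  rwa [map_id_apply] at this

/-- M(X) is a finitely generated module over the artinian ring R, so its submodules satisfy the
descending chain condition. -/
lemma IsDualizingVariety.exists_minimal_sub (hC : IsDualizingVariety R C) {M : Mod C}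
    (hM : IsFinPres M) (X : C) {s : Set (Sub M)} (hs : s.Nonempty) :
    ∃ N ∈ s, ∀ N' ∈ s, N'.carrier X ≤ N.carrier X → N.carrier X ≤ N'.carrier X := by
  have := hC.isArtinianRing
  obtain ⟨A, p, hp⟩ := hM.exists_generator
  have := hC.homFinite A X
  have : Module.Finite R (((toModuleCat R).obj M).obj X) := by
    let q : (A ⟶ X) →ₗ[R] ((toModuleCat R).obj M).obj X :=
      { toFun := fun f => M.obj.map f (elt p)
        map_add' := fun f g => map_add_apply M f g _
        map_smul' := fun r f => by
          change M.obj.map (r • f) (elt p) = M.obj.map (r • 𝟙 X) (M.obj.map f (elt p))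
          rw [← map_comp_apply, Linear.comp_smul, Category.comp_id] }
    refine Module.Finite.of_surjective q fun x => ?_
    obtain ⟨f, hf⟩ := (epi_iff p).1 hp X x
    obtain ⟨f, rfl⟩ := el.surjective f
    exact ⟨f, (app_el p f).symm.trans hf⟩
  obtain ⟨N, hN, hmin⟩ := exists_minimalFor_of_wellFoundedLT (· ∈ s)
    (fun N : Sub M => N.submodule R X) hs
  exact ⟨N, hN, fun N' hN' hle => hmin hN' hle⟩

/-- The kernel of a morphism, as a submodule. -/
def kerSub {M N : Mod C} (φ : M ⟶ N) : Sub M where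
  carrier A := (φ.hom.app A).hom.ker
  map_mem f x hx := by
    change φ.hom.app _ (M.obj.map f x) = 0
    rw [app_map]
    exact (congrArg _ hx).trans (map_zero (N.obj.map f).hom)

lemma mem_kerSub {M N : Mod C} (φ : M ⟶ N) {A : C} (x : M.obj.obj A) :
    x ∈ (kerSub φ).carrier A ↔ φ.hom.app A x = 0 := Iff.rfl

lemma biproduct_lift_app_eq_zero {n : ℕ} {M N : Mod C} (φ : Fin n → (N ⟶ M)) {A : C}
    (x : N.obj.obj A) :
    (biproduct.lift (f := fun _ : Fin n => M) φ).hom.app A x = 0 ↔ ∀ i, (φ i).hom.app A x = 0 := by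
  constructor
  · intro h i
    rw [← biproduct.lift_π (f := fun _ : Fin n => M) φ i, comp_app, h, map_zero]
  · intro h
    refine biproduct_app_eq_zero fun i => ?_
    rw [← comp_app, biproduct.lift_π, h]

/-- If elements of `M(X)` outside of `N(X)` are separated from `N` by morphisms to `J`, then
finitely many morphisms suffice. -/
lemma IsDualizingVariety.exists_separating_family (hC : IsDualizingVariety R C) {M J : Mod C}
    (hM : IsFinPres M) (X : C) (N : Sub M)
    (h : ∀ x : M.obj.obj X, x ∉ N.carrier X → ∃ ψ : M ⟶ J,
      (∀ A (w : M.obj.obj A), w ∈ N.carrier A → ψ.hom.app A w = 0) ∧ ψ.hom.app X x ≠ 0) :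
    ∃ (n : ℕ) (Ψ : M ⟶ ⨁ fun _ : Fin n => J),
      (∀ A (w : M.obj.obj A), w ∈ N.carrier A → Ψ.hom.app A w = 0) ∧
      ∀ x : M.obj.obj X, Ψ.hom.app X x = 0 → x ∈ N.carrier X := by
  let s : Set (Sub M) := {K | ∃ (n : ℕ) (φ : Fin n → (M ⟶ J)),
    (∀ A (w : M.obj.obj A), w ∈ N.carrier A → ∀ i, (φ i).hom.app A w = 0) ∧
      K = kerSub (biproduct.lift (f := fun _ : Fin n => J) φ)}
  obtain ⟨_, ⟨n, φ, hφ, rfl⟩, hmin⟩ := hC.exists_minimal_sub hM X (s := s)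
    ⟨_, 0, Fin.elim0, fun _ _ _ i => i.elim0, rfl⟩
  refine ⟨n, biproduct.lift φ, fun A w hw => (biproduct_lift_app_eq_zero _ _).2 (hφ A w hw),
    fun x hx => ?_⟩
  by_contra hxN
  obtain ⟨ψ, hψ, hψx⟩ := h x hxN
  let φ' : Fin (n + 1) → (M ⟶ J) := Fin.cons ψ φ
  have h1 : kerSub (biproduct.lift (f := fun _ : Fin (n + 1) => J) φ') ∈ s := by
    refine ⟨_, _, fun A w hw i => ?_, rfl⟩
    refine Fin.cases ?_ (fun i => ?_) i
    · exact hψ A w hw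
    · exact hφ A w hw i
  have h2 := hmin _ h1 (fun y hy => by
    rw [mem_kerSub, biproduct_lift_app_eq_zero] at hy ⊢
    exact fun i => hy i.succ) hx
  rw [mem_kerSub, biproduct_lift_app_eq_zero] at h2
  exact hψx (h2 0)

/-- The quotient map onto the quotient by a submodule. -/
def Sub.π {M : Mod C} (N : Sub M) : M ⟶ N.quotient := cokernel.π N.ι

instance {M : Mod C} (N : Sub M) : Epi N.π := inferInstanceAs (Epi (cokernel.π _))

lemma Sub.π_app_eq_zero {M : Mod C} (N : Sub M) {A : C} (x : M.obj.obj A) :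
    N.π.hom.app A x = 0 ↔ x ∈ N.carrier A := by
  constructor
  · intro hx
    obtain ⟨y, rfl⟩ := (exact_iff (ShortComplex.mk N.ι (cokernel.π N.ι) (cokernel.condition N.ι))).1
      (ShortComplex.exact_cokernel N.ι) A x hx
    exact y.2
  · intro hx
    have : N.ι ≫ N.π = 0 := cokernel.condition N.ι
    exact congrArg (fun f : N.toMod ⟶ N.quotient => f.hom.app A ⟨x, hx⟩) this

instance {M : Mod C} (N : Sub M) : Mono N.ι := (mono_iff _).2 fun _ _ hx => Subtype.ext hx

/-- A module without nonzero submodules vanishing at `X`. -/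
def TorsionFree (X : C) (M : Mod C) : Prop :=
  ∀ (A : C) (x : M.obj.obj A), (∀ g : A ⟶ X, M.obj.map g x = 0) → x = 0

lemma TorsionFree.of_mono {X : C} {M N : Mod C} (hN : TorsionFree X N) (f : M ⟶ N) [Mono f] :
    TorsionFree X M := fun A x hx => by
  refine (mono_iff f).1 inferInstance A x (hN A _ fun g => ?_)
  rw [← app_map, hx, map_zero]

lemma TorsionFree.biproduct {X : C} {M : Mod C} (hM : TorsionFree X M) (n : ℕ) :
    TorsionFree X (⨁ fun _ : Fin n => M) := fun A x hx =>
  biproduct_app_eq_zero fun i => hM A _ fun g => by rw [← app_map, hx, map_zero]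

lemma TorsionFree.of_add {X : C} {M N : Mod C} (hM : TorsionFree X M) (hN : add M N) :
    TorsionFree X N := by
  obtain ⟨Y, n, ⟨e⟩⟩ := hN
  exact (hM.biproduct n).of_mono (biprod.inl ≫ e.hom)

/-! ### The radical of a representable module -/

/-- The left ideal of `End X` given by a submodule of `Hom_C(X, -)`. -/
def Sub.ideal {X : C} (N : Sub (rep X)) : Ideal (End X) where
  carrier := {x | el x ∈ N.carrier X}
  add_mem' {x y} hx hy := by
    change el (x + y) ∈ _
    rw [map_add]
    exact (N.carrier X).add_mem hx hy
  zero_mem' := by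
    change el (0 : X ⟶ X) ∈ _
    rw [map_zero]
    exact (N.carrier X).zero_mem
  smul_mem' r x hx := N.map_mem r hx

lemma Sub.mem_ideal {X : C} (N : Sub (rep X)) (x : End X) :
    x ∈ N.ideal ↔ el (B := X) x ∈ N.carrier X := Iff.rfl

lemma Sub.eq_top_of_ideal_eq_top {X : C} {N : Sub (rep X)} (h : N.ideal = ⊤) : N = ⊤ := by
  have h1 : (1 : End X) ∈ N.ideal := h ▸ Submodule.mem_top
  rw [Sub.mem_ideal] at h1
  ext A x
  refine ⟨fun _ => AddSubgroup.mem_top _, fun _ => ?_⟩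
  obtain ⟨x, rfl⟩ := el.surjective x
  have := N.map_mem x h1
  rw [rep_map] at this
  exact (Category.id_comp x) ▸ this

/-- The submodule of `Hom_C(X, -)` generated by a left ideal of `End X`, in the largest way. -/
def idealSub {X : C} (m : Ideal (End X)) : Sub (rep X) where
  carrier A :=
    { carrier := {x | ∀ k : A ⟶ X, (show End X from el.symm x ≫ k) ∈ m}
      add_mem' := fun {x y} hx hy k => by
        change (show End X from el.symm (x + y) ≫ k) ∈ m
        rw [map_add, Preadditive.add_comp]
        exact m.add_mem (hx k) (hy k)
      zero_mem' := fun k => by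
        rw [map_zero, zero_comp]
        exact m.zero_mem
      neg_mem' := fun {x} hx k => by
        change (show End X from el.symm (-x) ≫ k) ∈ m
        rw [map_neg, Preadditive.neg_comp]
        exact m.neg_mem (hx k) }
  map_mem f x hx k := by
    obtain ⟨x, rfl⟩ := el.surjective x
    rw [rep_map, AddEquiv.symm_apply_apply, Category.assoc]
    exact hx (f ≫ k)

lemma mem_idealSub {X A : C} (m : Ideal (End X)) (x : X ⟶ A) :
    el x ∈ (idealSub m).carrier A ↔ ∀ k : A ⟶ X, (show End X from x ≫ k) ∈ m := Iff.rfl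

/-- Maximal submodules of Hom(X, -) correspond to maximal left ideals of End X by evaluation at X,
with inverse `idealSub`. -/
lemma mem_rad_rep {X A : C} (x : X ⟶ A) : el x ∈ (rad (rep X)).carrier A ↔
    ∀ k : A ⟶ X, (show End X from x ≫ k) ∈ Ring.jacobson (End X) := by
  simp only [rad, AddSubgroup.mem_iInf, ← Ideal.jacobson_bot, Ideal.jacobson, Ideal.mem_sInf]
  constructor
  · rintro h k m ⟨-, hm⟩
    refine h (idealSub m) ⟨fun ht => ?_, fun N hN => ?_⟩ k
    · have : el (𝟙 X) ∈ (idealSub m).carrier X := ht ▸ AddSubgroup.mem_top _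
      have h1 := (mem_idealSub m _).1 this (𝟙 X)
      rw [Category.comp_id] at h1
      exact hm.ne_top ((Ideal.eq_top_iff_one m).2 h1)
    · apply Sub.eq_top_of_ideal_eq_top
      by_contra hNt
      have h1 : m ≤ N.ideal := fun y hy => hN.le X fun k => m.mul_mem_left k hy
      have h2 : m = N.ideal := hm.eq_of_le hNt h1
      refine hN.not_ge fun A y hy k => ?_
      obtain ⟨y, rfl⟩ := el.surjective y
      rw [h2]
      exact N.map_mem k hy
  · intro h N hN
    by_contra hx
    have hNt : N.ideal ≠ ⊤ := fun ht => hN.1 (Sub.eq_top_of_ideal_eq_top ht)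
    obtain ⟨m, hm, hNm⟩ := Ideal.exists_le_maximal _ hNt
    -- N' is the sum of N and the submodule generated by x; it is everything if x is not in N, which
    -- puts 1 in m.
    let N' : Sub (rep X) :=
      { carrier := fun B =>
          N.carrier B ⊔ (AddSubgroup.map ((yon (el x)).hom.app B).hom ⊤)
        map_mem := fun {B D} f y hy => by
          obtain ⟨y₁, hy₁, _, ⟨h, -, rfl⟩, rfl⟩ := AddSubgroup.mem_sup.1 hy
          rw [map_add]
          refine AddSubgroup.add_mem_sup (N.map_mem f hy₁) ⟨(rep A).obj.map f h, trivial, ?_⟩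
          exact app_map (yon (el x)) f h }
    have hlt : N < N' := by
      refine lt_of_le_of_ne (fun B => le_sup_left) fun heq => hx ?_
      rw [heq]
      refine AddSubgroup.mem_sup_right ⟨el (𝟙 A), trivial, ?_⟩
      exact map_id_apply (rep X) (el x)
    have h1 : el (𝟙 X) ∈ N'.carrier X := hN.2 _ hlt ▸ AddSubgroup.mem_top _
    obtain ⟨y, hy, _, ⟨k, -, rfl⟩, hyk⟩ := AddSubgroup.mem_sup.1 h1
    obtain ⟨y, rfl⟩ := el.surjective y
    obtain ⟨k, rfl⟩ := el.surjective k
    have h2 : y + x ≫ k = 𝟙 X := el.injective ((map_add el y (x ≫ k)).trans hyk)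
    refine hm.ne_top ((Ideal.eq_top_iff_one m).2 ?_)
    have h3 := m.add_mem (hNm hy) (h k ⟨bot_le, hm⟩)
    exact (show y + x ≫ k = (1 : End X) from h2) ▸ h3

lemma torsionFree_rep_quotient_rad (X : C) : TorsionFree X (rad (rep X)).quotient := by
  intro A x hx
  obtain ⟨x, rfl⟩ := (epi_iff (rad (rep X)).π).1 inferInstance A x
  obtain ⟨x, rfl⟩ := el.surjective x
  rw [Sub.π_app_eq_zero, mem_rad_rep]
  intro k
  have := hx k
  rw [← app_map, Sub.π_app_eq_zero, rep_map, mem_rad_rep] at this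
  simpa using this (𝟙 X)

/-- The radical is tested at X, so it is the kernel of a single map to a finite power of a
separating module, and such kernels are finitely presented. -/
lemma IsDualizingVariety.isFinPres_quotient_rad (hC : IsDualizingVariety R C) (X : C) :
    IsFinPres (rad (rep X)).quotient := by
  have := hC.hasFiniteBiproducts
  obtain ⟨J, hJ⟩ := hC.exists_separating X
  obtain ⟨n, Ψ, hΨ, hΨX⟩ := hC.exists_separating_family (isFinPres_rep X) X (rad (rep X))
    (J := J.obj) fun x hx => hJ (isFinPres_rep X) _ hx
  obtain ⟨K, k, hK, hk, hk'⟩ := hC.exists_kernel (isFinPres_rep X)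
    (isFinPres_biproduct J.property n) Ψ
  obtain ⟨A, q, hq⟩ := hK.exists_generator
  refine isFinPres_of_exact q (isFinPres_rep X) k (rad (rep X)).π fun B x => ?_
  rw [Sub.π_app_eq_zero, ← hk']
  refine ⟨hΨ B x, fun hx => ?_⟩
  obtain ⟨x, rfl⟩ := el.surjective x
  rw [mem_rad_rep]
  intro l
  have := hΨX (el (x ≫ l)) (by rw [← rep_map, app_map, hx, map_zero])
  rw [mem_rad_rep] at this
  simpa using this (𝟙 X)

end

/-! ### The injective envelope of the top and torsion -/

section Envelope

variable {R : Type u} [CommRing R] {C : Type u} [SmallCategory C] [Preadditive C] [Linear R C]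

lemma FpMod.exists_extension {J : FpMod C} [Injective J] {M N : Mod C} (hM : IsFinPres M)
    (hN : IsFinPres N) (m : M ⟶ N) [Mono m] (f : M ⟶ J.obj) : ∃ ψ : N ⟶ J.obj, m ≫ ψ = f := by
  let m' : (⟨M, hM⟩ : FpMod C) ⟶ ⟨N, hN⟩ := ObjectProperty.homMk m
  have : Mono m' := (FpMod.mono_iff m').2 (inferInstanceAs (Mono m))
  exact ⟨(Injective.factorThru (ObjectProperty.homMk f) m').hom,
    congrArg (fun g => g.hom) (Injective.comp_factorThru (ObjectProperty.homMk f) m')⟩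

lemma FpMod.injective_biproduct [HasFiniteBiproducts C] {J : FpMod C} [Injective J] (n : ℕ) :
    Injective (⟨_, isFinPres_biproduct J.property n⟩ : FpMod C) where
  factors {M N} g f hf := by
    have := (FpMod.mono_iff f).1 hf
    choose ψ hψ using fun i : Fin n => FpMod.exists_extension (J := J) M.property N.property f.hom
      (g.hom ≫ biproduct.π _ i)
    refine ⟨ObjectProperty.homMk (biproduct.lift ψ), ObjectProperty.hom_ext _ ?_⟩
    refine biproduct.hom_ext _ _ fun i => ?_
    change (f.hom ≫ biproduct.lift ψ) ≫ _ = g.hom ≫ _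
    rw [Category.assoc, biproduct.lift_π, hψ]

lemma add_biproduct (M : Mod C) (n : ℕ) : add M (⨁ fun _ : Fin n => M) := by
  obtain ⟨Z, hZ⟩ := HasZeroObject.zero (C := Mod C)
  exact ⟨Z, n, ⟨(isoBiprodZero hZ).symm⟩⟩

variable {X : C}

/-- The submodule generated by a torsion element x meets S trivially, so S still embeds after
dividing it out. Essentiality then makes the quotient map mono, whence x = 0. -/
lemma TorsionFree.of_envelope [HasFiniteBiproducts C] {S J : FpMod C} (hS : TorsionFree X S.obj)
    {i : S ⟶ J} (hi : IsInjectiveEnvelope i) : TorsionFree X J.obj := by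
  intro A x hx
  let T : FpMod C := ⟨_, isFinPres_cokernel (isFinPres_rep A) J.property (yon x)⟩
  let g : J ⟶ T := ObjectProperty.homMk (cokernel.π (yon x))
  have := (FpMod.mono_iff i).1 hi.mono
  have h1 : Mono (i ≫ g) := by
    rw [FpMod.mono_iff, mono_iff]
    intro B s hs
    obtain ⟨y, hy⟩ := (exact_iff (ShortComplex.mk (yon x) (cokernel.π (yon x))
      (cokernel.condition _))).1 (ShortComplex.exact_cokernel _) B (i.hom.hom.app B s) hs
    obtain ⟨h, rfl⟩ := el.surjective y
    refine hS B s fun k => (mono_iff i.hom).1 inferInstance X _ ?_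
    rw [app_map, ← hy]
    change J.obj.obj.map k (J.obj.obj.map h x) = 0
    rw [← map_comp_apply, hx]
  have h2 := (FpMod.mono_iff g).1 (hi.essential g h1)
  refine (mono_iff g.hom).1 h2 A x ?_
  have h3 : yon x ≫ cokernel.π (yon x) = 0 := cokernel.condition _
  rw [yon_comp] at h3
  exact yon_injective (h3.trans yon_zero.symm)

/-- The injective envelope of the top of `Hom_C(X, -)` detects elements with nonzero value
at `X`. -/
lemma IsDualizingVariety.exists_app_ne_zero (hC : IsDualizingVariety R C) {S J : FpMod C}
    (e : S.obj ≅ (rad (rep X)).quotient) {i : S ⟶ J} (hi : IsInjectiveEnvelope i) {Y : Mod C}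
    (hY : IsFinPres Y) {z : Y.obj.obj X} (hz : z ≠ 0) : ∃ ψ : Y ⟶ J.obj, ψ.hom.app X z ≠ 0 := by
  have := hC.hasFiniteBiproducts
  have := hC.isArtinianRing
  have := hC.homFinite X X
  have : Module.Finite R (End X) := this
  have : IsArtinianRing (End X) := IsArtinianRing.of_finite R (End X)
  have := hi.injective
  have := (FpMod.mono_iff i).1 hi.mono
  obtain ⟨K, k, hK, hk, hk'⟩ := hC.exists_kernel (isFinPres_rep X) hY (yon z)
  have hL : (kerSub (yon z)).ideal ≠ ⊤ := fun h => hz (by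
    have : (1 : End X) ∈ (kerSub (yon z)).ideal := h ▸ Submodule.mem_top
    rw [Sub.mem_ideal, mem_kerSub] at this
    exact (map_id_apply Y z).symm.trans this)
  obtain ⟨a, ha, haL⟩ := exists_mul_mem_jacobson hL
  -- Composition with a followed by the map to the top. It kills the annihilator of z by the choice
  -- of a, so it factors through the submodule generated by z and extends to Y.
  let p : rep X ⟶ J.obj := yon (el (B := X) a) ≫ (rad (rep X)).π ≫ e.inv ≫ i.hom
  have hp : ∀ B (x : X ⟶ B), p.hom.app B (el x) = 0 ↔
      el ((show X ⟶ X from a) ≫ x) ∈ (rad (rep X)).carrier B := by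
    intro B x
    rw [← Sub.π_app_eq_zero]
    constructor
    · intro h
      exact (mono_iff (e.inv ≫ i.hom)).1 inferInstance B _ h
    · intro h
      change (e.inv ≫ i.hom).hom.app B ((rad (rep X)).π.hom.app B _) = 0
      exact (congrArg _ h).trans (map_zero ((e.inv ≫ i.hom).hom.app B).hom)
  have hkz : k ≫ yon z = 0 := Mod.hom_ext' fun A y => (hk' A _).2 ⟨y, rfl⟩
  have hN : IsFinPres (cokernel k) := isFinPres_cokernel hK (isFinPres_rep X) k
  let m : cokernel k ⟶ Y := cokernel.desc k (yon z) hkz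
  have hm : Mono m := by
    rw [mono_iff]
    intro A x hx
    obtain ⟨x, rfl⟩ := (epi_iff (cokernel.π k)).1 inferInstance A x
    rw [← comp_app, cokernel.π_desc, hk'] at hx
    obtain ⟨y, rfl⟩ := hx
    rw [← comp_app, cokernel.condition, zero_app]
  have hkp : k ≫ p = 0 := Mod.hom_ext' fun A y => by
    rw [comp_app, zero_app]
    have h1 : (yon z).hom.app A (k.hom.app A y) = 0 := (hk' A _).2 ⟨y, rfl⟩
    obtain ⟨x, hx⟩ := el.surjective (k.hom.app A y)
    rw [← hx] at h1 ⊢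
    rw [hp, mem_rad_rep]
    intro l
    have h2 : (show End X from x ≫ l) ∈ (kerSub (yon z)).ideal := by
      rw [Sub.mem_ideal, mem_kerSub]
      rw [← rep_map, app_map, h1, map_zero]
    have h3 := haL _ h2
    rw [Category.assoc]
    exact h3
  obtain ⟨ψ, hψ⟩ := FpMod.exists_extension hN hY m (cokernel.desc k p hkp)
  refine ⟨ψ, fun h0 => ha ?_⟩
  have h1 : yon z ≫ ψ = p := by
    rw [← cokernel.π_desc k (yon z) hkz, Category.assoc]
    change _ ≫ m ≫ ψ = _
    rw [hψ, cokernel.π_desc]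
  rw [yon_comp, h0, yon_zero] at h1
  have h2 := (hp X (𝟙 X)).1 (by rw [← h1, zero_app])
  rw [Category.comp_id, mem_rad_rep] at h2
  have := h2 (𝟙 X)
  rwa [Category.comp_id] at this

/-- The torsion submodule: the largest submodule vanishing at `X`. -/
def torsion (X : C) (M : Mod C) : Sub M where
  carrier A :=
    { carrier := {x | ∀ g : A ⟶ X, M.obj.map g x = 0}
      add_mem' := fun {x y} hx hy g => by rw [map_add, hx g, hy g, add_zero]
      zero_mem' := fun g => map_zero _
      neg_mem' := fun {x} hx g => by rw [map_neg, hx g, neg_zero] }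
  map_mem f x hx g := by rw [← map_comp_apply, hx]

lemma mem_torsion {M : Mod C} {A : C} (x : M.obj.obj A) :
    x ∈ (torsion X M).carrier A ↔ ∀ g : A ⟶ X, M.obj.map g x = 0 := Iff.rfl

/-- Torsion dies in the torsion free J, while a non-torsion element has a nonzero translate at X,
which J detects. Finite length at X reduces to finitely many maps. -/
lemma IsDualizingVariety.exists_kernel_torsion (hC : IsDualizingVariety R C) {S J : FpMod C}
    (e : S.obj ≅ (rad (rep X)).quotient) {i : S ⟶ J} (hi : IsInjectiveEnvelope i) {Y : Mod C}
    (hY : IsFinPres Y) : ∃ (n : ℕ) (Ψ : Y ⟶ ⨁ fun _ : Fin n => J.obj),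
      ∀ A (y : Y.obj.obj A), Ψ.hom.app A y = 0 ↔ ∀ g : A ⟶ X, Y.obj.map g y = 0 := by
  have := hC.hasFiniteBiproducts
  have hJ : TorsionFree X J.obj :=
    ((torsionFree_rep_quotient_rad X).of_mono e.hom).of_envelope hi
  obtain ⟨n, Ψ, h1, h2⟩ := hC.exists_separating_family (J := J.obj) hY X (torsion X Y) fun x hx => by
    rw [mem_torsion, not_forall] at hx
    obtain ⟨g, hg⟩ := hx
    obtain ⟨ψ, hψ⟩ := hC.exists_app_ne_zero e hi hY hg
    refine ⟨ψ, fun A w hw => hJ A _ fun g => ?_, fun h => hψ ?_⟩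
    · rw [← app_map, hw g, map_zero]
    · rw [app_map, h, map_zero]
  refine ⟨n, Ψ, fun A y => ⟨fun hy g => ?_, h1 A y⟩⟩
  have := h2 (Y.obj.map g y) (by rw [app_map, hy, map_zero]) (𝟙 X)
  rwa [map_id_apply] at this

lemma IsDualizingVariety.exists_mono_of_torsionFree (hC : IsDualizingVariety R C) {S J : FpMod C}
    (e : S.obj ≅ (rad (rep X)).quotient) {i : S ⟶ J} (hi : IsInjectiveEnvelope i) {Y : Mod C}
    (hY : IsFinPres Y) (hYX : TorsionFree X Y) :
    ∃ (n : ℕ) (Ψ : Y ⟶ ⨁ fun _ : Fin n => J.obj), Mono Ψ := by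
  obtain ⟨n, Ψ, h⟩ := hC.exists_kernel_torsion e hi hY
  exact ⟨n, Ψ, (mono_iff Ψ).2 fun A y hy => hYX A y ((h A y).1 hy)⟩

lemma IsDualizingVariety.exists_topEnvelope (hC : IsDualizingVariety R C) (X : C) :
    ∃ (S J : FpMod C) (_ : S.obj ≅ (rad (rep X)).quotient) (i : S ⟶ J), IsInjectiveEnvelope i := by
  obtain ⟨J, i, hi⟩ := hC.exists_injectiveEnvelope ⟨_, hC.isFinPres_quotient_rad X⟩
  exact ⟨_, J, Iso.refl _, i, hi⟩

/-- Construction of injective coresolutions by recursion. -/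
lemma exists_injCoresolution (Pred Q : ℕ → FpMod C → Prop)
    (step : ∀ n Y, Pred n Y → ∃ (J : FpMod C) (ε : Y ⟶ J) (Z : FpMod C) (p : J ⟶ Z),
      Injective J ∧ Q n J ∧ Mono ε.hom ∧ Epi p.hom ∧ Pred (n + 1) Z ∧
      ∀ A (x : J.obj.obj.obj A), p.hom.hom.app A x = 0 ↔ ∃ y, ε.hom.hom.app A y = x)
    {Y : FpMod C} (hY : Pred 0 Y) : ∃ r : InjCoresolution Y, ∀ n, Q n (r.J n) := by
  choose J ε Z p hJ hQ hε hp hZ hex using step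
  -- The n-th entry is the n-th cosyzygy, together with the invariant needed to continue.
  let seq : ∀ n, {Y : FpMod C // Pred n Y} :=
    fun n => Nat.rec ⟨Y, hY⟩ (fun n Y => ⟨Z n Y.1 Y.2, hZ n Y.1 Y.2⟩) n
  have hm : ∀ n, Mono (ε n (seq n).1 (seq n).2).hom := fun n => hε _ _ _
  have hpe : ∀ n, Epi (p n (seq n).1 (seq n).2).hom := fun n => hp _ _ _
  let d : ∀ n, J n (seq n).1 (seq n).2 ⟶ J (n + 1) (seq (n + 1)).1 (seq (n + 1)).2 := fun n =>
    p n (seq n).1 (seq n).2 ≫ ε (n + 1) (seq (n + 1)).1 (seq (n + 1)).2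
  have hd : ∀ n A x, (d n).hom.hom.app A x = 0 ↔ ∃ y, (ε n (seq n).1 (seq n).2).hom.hom.app A y = x := by
    intro n A x
    rw [← hex]
    constructor
    · intro h
      exact (mono_iff _).1 (hm (n + 1)) A _ h
    · intro h
      exact (congrArg _ h).trans (map_zero ((ε (n + 1) _ _).hom.hom.app A).hom)
  refine ⟨{ J := fun n => J n (seq n).1 (seq n).2
            injective := fun n => hJ _ _ _
            ε := ε 0 (seq 0).1 (seq 0).2
            d := d
            mono := hm 0
            ε_d := Mod.hom_ext' fun A y => (hd 0 A _).2 ⟨y, rfl⟩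
            d_d := fun n => Mod.hom_ext' fun A y => (hd (n + 1) A _).2 ⟨_, rfl⟩
            exact_zero := (exact_iff _).2 fun A x hx => (hd 0 A x).1 hx
            exact_succ := fun n => (exact_iff _).2 fun A x hx => ?_ }, fun n => hQ _ _ _⟩
  obtain ⟨y, rfl⟩ := (hd (n + 1) A x).1 hx
  obtain ⟨z, rfl⟩ := (epi_iff _).1 (hpe n) A y
  exact ⟨z, rfl⟩

end Envelope

/-! ### The trace ideal of a representable -/

section Trace

variable {R : Type u} [CommRing R] {C : Type u} [SmallCategory C] [Preadditive C] [Linear R C]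
variable {X : C}

/-- With `traceIdeal_hom_le`, this says that I(A, B) is the subgroup generated by the morphisms
factoring through X. -/
lemma comp_mem_traceIdeal {A B : C} (a : A ⟶ X) (b : X ⟶ B) :
    a ≫ b ∈ (traceIdeal (rep X)).hom A B :=
  (le_iSup (fun φ : rep X ⟶ rep A => (φ.hom.app B).hom.range) (yon (el a))) ⟨el b, rfl⟩

lemma traceIdeal_hom_le {A B : C} {G : AddSubgroup (A ⟶ B)}
    (h : ∀ (a : A ⟶ X) (b : X ⟶ B), a ≫ b ∈ G) : (traceIdeal (rep X)).hom A B ≤ G := by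
  refine iSup_le fun φ => ?_
  rintro _ ⟨b, rfl⟩
  obtain ⟨b, rfl⟩ := el.surjective b
  obtain ⟨a, ha⟩ := el.surjective (elt φ)
  have : φ.hom.app B (el b) = el (a ≫ b) := by rw [app_el, ← ha, rep_map]
  change φ.hom.app B (el b) ∈ _
  exact this ▸ h a b

lemma map_eq_zero_of_mem_traceIdeal {M : Mod C} {A B : C} {y : M.obj.obj A}
    (hy : ∀ g : A ⟶ X, M.obj.map g y = 0) {f : A ⟶ B} (hf : f ∈ (traceIdeal (rep X)).hom A B) :
    M.obj.map f y = 0 := by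
  let G : AddSubgroup (A ⟶ B) :=
    { carrier := {f | M.obj.map f y = 0}
      add_mem' := fun {f g} hf hg => by
        change M.obj.map (f + g) y = 0
        rw [map_add_apply, hf, hg, add_zero]
      zero_mem' := map_zero_apply M y
      neg_mem' := fun {f} hf => by
        have := map_add_apply M (-f) f y
        rw [neg_add_cancel, map_zero_apply, hf, add_zero] at this
        exact this.symm }
  exact traceIdeal_hom_le (G := G) (fun a b => (map_comp_apply M a b y).trans
    (by rw [hy, map_zero])) hf

lemma mem_traceIdeal_of_right {A : C} (g : A ⟶ X) : g ∈ (traceIdeal (rep X)).hom A X := by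
  have := comp_mem_traceIdeal (X := X) g (𝟙 X)
  rwa [Category.comp_id] at this

/-- Finitely many generators of the R-module C(A, X) assemble to a map A ⟶ X^n through which every
morphism A ⟶ X factors. -/
lemma IsDualizingVariety.exists_traceIdeal_generator (hC : IsDualizingVariety R C) (X A : C) :
    ∃ (W : C) (a : A ⟶ W), ∀ B (f : A ⟶ B),
      f ∈ (traceIdeal (rep X)).hom A B ↔ ∃ h : W ⟶ B, a ≫ h = f := by
  have := hC.hasFiniteBiproducts
  have := hC.homFinite A X
  obtain ⟨n, s, hs⟩ := Module.Finite.exists_fin (R := R) (M := A ⟶ X)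
  refine ⟨⨁ fun _ : Fin n => X, biproduct.lift s, fun B f => ⟨fun hf => ?_, ?_⟩⟩
  · let G : AddSubgroup (A ⟶ B) := (Preadditive.leftComp B (biproduct.lift s)).range
    refine traceIdeal_hom_le (G := G) (fun c b => ?_) hf
    obtain ⟨r, rfl⟩ := (Submodule.mem_span_range_iff_exists_fun R).1
      (hs ▸ Submodule.mem_top : c ∈ Submodule.span R (Set.range s))
    refine ⟨biproduct.desc fun i => r i • b, ?_⟩
    change biproduct.lift s ≫ biproduct.desc _ = _
    rw [biproduct.lift_desc, Preadditive.sum_comp]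
    simp
  · rintro ⟨h, rfl⟩
    have : h = biproduct.desc fun i => biproduct.ι (fun _ : Fin n => X) i ≫ h := by
      ext i
      simp
    rw [this, biproduct.lift_desc]
    exact sum_mem fun i _ => comp_mem_traceIdeal _ _

/-- The `C`-module `I(A, -)` for the trace ideal `I` of `Hom_C(X, -)`. -/
abbrev traceMod (X A : C) : Mod C := ((traceIdeal (rep X)).homSub A).toMod

/-- The inclusion of `I(A, -)` in `Hom_C(A, -)`. -/
abbrev traceι (X A : C) : traceMod X A ⟶ rep A := ((traceIdeal (rep X)).homSub A).ι

lemma exists_traceι_app {X A B : C} {f : A ⟶ B} (hf : f ∈ (traceIdeal (rep X)).hom A B) :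
    ∃ y, (traceι X A).hom.app B y = el f := ⟨⟨el f, hf⟩, rfl⟩

lemma exists_eq_traceι_app {X A B : C} (y : (traceMod X A).obj.obj B) :
    ∃ f ∈ (traceIdeal (rep X)).hom A B, (traceι X A).hom.app B y = el f := ⟨y.1, y.2, rfl⟩

/-- `I(A, -)` has a presentation by a representable and a finitely presented module. -/
lemma IsDualizingVariety.exists_traceMod_presentation (hC : IsDualizingVariety R C) (X A : C) :
    IsFinPres (traceMod X A) ∧ ∃ (W : C) (K : Mod C) (k : K ⟶ rep W) (p : rep W ⟶ traceMod X A)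
      (w : k ≫ p = 0), IsFinPres K ∧ (ShortComplex.mk k p w).ShortExact := by
  have := hC.hasFiniteBiproducts
  obtain ⟨W, a, ha⟩ := hC.exists_traceIdeal_generator X A
  obtain ⟨p, hp⟩ := exists_lift_of_mono (traceι X A) (yon (el a)) (fun B h => by
    obtain ⟨h, rfl⟩ := el.surjective h
    exact exists_traceι_app ((ha B (a ≫ h)).2 ⟨h, rfl⟩))
  have hpe : Epi p := by
    rw [epi_iff]
    intro B y
    obtain ⟨f, hf, hy⟩ := exists_eq_traceι_app y
    obtain ⟨h, rfl⟩ := (ha B f).1 hf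
    refine ⟨el h, app_injective (traceι X A) ?_⟩
    rw [← comp_app, hp, hy]
    rfl
  obtain ⟨K, k, hK, hk, hk'⟩ := hC.exists_kernel (isFinPres_rep W) (isFinPres_rep A) (yon (el a))
  have hpz : ∀ B (x : (rep W).obj.obj B), p.hom.app B x = 0 ↔ ∃ y, k.hom.app B y = x := by
    intro B x
    rw [← hk', ← hp, comp_app]
    exact ⟨fun h => by rw [h, map_zero], fun h => (mono_iff (traceι X A)).1 inferInstance B _ h⟩
  obtain ⟨D, q, hq⟩ := hK.exists_generator
  refine ⟨isFinPres_of_exact q (isFinPres_rep W) k p hpz, W, K, k, p,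
    Mod.hom_ext' fun B y => (hpz B _).2 ⟨y, rfl⟩, hK, ?_⟩
  exact { exact := (exact_iff _).2 fun B x hx => (hpz B x).1 hx }

end Trace

/-! ### Projective traces give 𝕀₁ = 𝕀_∞ -/

section ProjectiveTrace

variable {R : Type u} [CommRing R] {C : Type u} [SmallCategory C] [Preadditive C] [Linear R C]
variable {X : C}

lemma InI.of_le (P : Mod C) {k l : ℕ∞} (h : k ≤ l) : InI P l ≤ InI P k := by
  rintro Y ⟨S, J, e, i, hi, r, hr⟩
  exact ⟨S, J, e, i, hi, r, fun n hn => hr n (hn.trans h)⟩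

lemma app_cokernel_π_eq_zero_iff {M N : Mod C} (f : M ⟶ N) {A : C} (x : N.obj.obj A) :
    (cokernel.π f).hom.app A x = 0 ↔ ∃ y, f.hom.app A y = x := by
  constructor
  · exact (exact_iff (ShortComplex.mk f (cokernel.π f) (cokernel.condition f))).1
      (ShortComplex.exact_cokernel f) A x
  · rintro ⟨y, rfl⟩
    rw [← comp_app, cokernel.condition, zero_app]

/-- If the cosyzygy of a morphism extending from `I(A, -)` embeds in a torsion free module, then
the extension lifts. -/
lemma exists_extension_of_exact {A : C} {M N K : Mod C} (ε : M ⟶ N) (d : N ⟶ K)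
    (hε : ∀ B (x : N.obj.obj B), d.hom.app B x = 0 ↔ ∃ y, ε.hom.app B y = x)
    (hK : TorsionFree X K) (α : traceMod X A ⟶ M) (β : rep A ⟶ N) (h : traceι X A ≫ β = α ≫ ε) :
    ∃ γ : rep A ⟶ M, γ ≫ ε = β := by
  -- On I(A, -) the map β lands in M, so β followed by d kills it. Every g : A ⟶ X is in I, so the
  -- element is torsion in K.
  have h0 : d.hom.app A (elt β) = 0 := by
    refine hK A _ fun g => ?_
    obtain ⟨y, hy⟩ := exists_traceι_app (mem_traceIdeal_of_right g)
    rw [← app_map, ← app_el, ← hy, ← comp_app (traceι X A) β, h, comp_app, hε]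
    exact ⟨_, rfl⟩
  obtain ⟨y, hy⟩ := (hε A _).1 h0
  exact ⟨yon y, by rw [yon_comp, hy, yon_elt]⟩

/-- The modules to which every morphism from some `I(A, -)` extends uniquely to `Hom_C(A, -)`. -/
def IsTraceClosed (X : C) (Y : Mod C) : Prop :=
  TorsionFree X Y ∧ ∀ (A : C) (α : traceMod X A ⟶ Y), ∃ β : rep A ⟶ Y, traceι X A ≫ β = α

lemma isTraceClosed_of_exact (hC : IsDualizingVariety R C) {Y : Mod C} {J : FpMod C} [Injective J]
    {K : Mod C} (ε : Y ⟶ J.obj) [Mono ε] (d : J.obj ⟶ K)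
    (hε : ∀ B (x : J.obj.obj.obj B), d.hom.app B x = 0 ↔ ∃ y, ε.hom.app B y = x)
    (hJ : TorsionFree X J.obj) (hK : TorsionFree X K) : IsTraceClosed X Y := by
  refine ⟨hJ.of_mono ε, fun A α => ?_⟩
  obtain ⟨β, hβ⟩ := FpMod.exists_extension (hC.exists_traceMod_presentation X A).1
    (isFinPres_rep A) (traceι X A) (α ≫ ε)
  obtain ⟨γ, hγ⟩ := exists_extension_of_exact ε d hε hK α β hβ
  exact ⟨γ, by rw [← cancel_mono ε, Category.assoc, hγ, hβ]⟩

/-- If w in J is torsion modulo Y, it maps I(A, -) into Y; the extension of that map differs from w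
by torsion of J, so w is in Y. For extensions, projectivity lifts I(A, -) ⟶ J/Y to J, where
injectivity applies. -/
lemma IsTraceClosed.cokernel (hC : IsDualizingVariety R C)
    (hP : ∀ A : C, Projective (traceMod X A)) {Y : Mod C} (hY : IsTraceClosed X Y)
    {J : FpMod C} [Injective J] (hJ : TorsionFree X J.obj) (ε : Y ⟶ J.obj) [Mono ε] :
    IsTraceClosed X (cokernel ε) := by
  refine ⟨fun A z hz => ?_, fun A α => ?_⟩
  · obtain ⟨w, rfl⟩ := (epi_iff (cokernel.π ε)).1 inferInstance A z
    obtain ⟨α, hα⟩ := exists_lift_of_mono ε (traceι X A ≫ yon w) fun B y => by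
      obtain ⟨f, hf, hy⟩ := exists_eq_traceι_app y
      rw [comp_app, hy, yon_app, ← app_cokernel_π_eq_zero_iff, app_map]
      exact map_eq_zero_of_mem_traceIdeal hz hf
    obtain ⟨β, hβ⟩ := hY.2 A α
    have h0 : w - ε.hom.app A (elt β) = 0 := by
      refine hJ A _ fun g => ?_
      obtain ⟨y, hy⟩ := exists_traceι_app (mem_traceIdeal_of_right g)
      rw [map_sub, sub_eq_zero, ← app_map, ← app_el, ← hy, ← comp_app (traceι X A), hβ, ← comp_app,
        hα, comp_app, hy, yon_app]
    rw [app_cokernel_π_eq_zero_iff]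
    exact ⟨_, (sub_eq_zero.1 h0).symm⟩
  · have := hP A
    obtain ⟨β, hβ⟩ := FpMod.exists_extension (hC.exists_traceMod_presentation X A).1
      (isFinPres_rep A) (traceι X A) (Projective.factorThru α (cokernel.π ε))
    exact ⟨β ≫ cokernel.π ε, by rw [reassoc_of% hβ, Projective.factorThru_comp]⟩

lemma IsDualizingVariety.inI_one_eq_top (hC : IsDualizingVariety R C)
    (hP : ∀ A : C, Projective (traceMod X A)) : InI (rep X) 1 = InI (rep X) ⊤ := by
  refine le_antisymm ?_ (InI.of_le _ le_top)
  rintro Y ⟨S, J, e, i, hi, r, hr⟩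
  have := hC.hasFiniteBiproducts
  have := hi.injective
  have hJ : TorsionFree X J.obj :=
    ((torsionFree_rep_quotient_rad X).of_mono e.hom).of_envelope hi
  have hY : IsTraceClosed X Y.obj := by
    have := r.injective 0
    have := r.mono
    refine isTraceClosed_of_exact hC r.ε.hom (r.d 0).hom (fun B x => ⟨?_, ?_⟩)
      (hJ.of_add (hr 0 (by simp))) (hJ.of_add (hr 1 (by simp)))
    · exact (exact_iff _).1 r.exact_zero B x
    · rintro ⟨y, rfl⟩
      rw [← comp_app, r.ε_d, zero_app]
  obtain ⟨r', hr'⟩ := exists_injCoresolution (fun _ Y => IsTraceClosed X Y.obj)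
    (fun _ K => add J.obj K.obj) (fun n Y hY => by
      obtain ⟨n, Ψ, hΨ⟩ := hC.exists_mono_of_torsionFree e hi Y.property hY.1
      let J' : FpMod C := ⟨_, isFinPres_biproduct J.property n⟩
      have : Injective J' := FpMod.injective_biproduct n
      let Z : FpMod C := ⟨_, isFinPres_cokernel Y.property J'.property Ψ⟩
      refine ⟨J', ObjectProperty.homMk Ψ, Z, ObjectProperty.homMk (cokernel.π Ψ), this,
        add_biproduct _ _, hΨ, inferInstanceAs (Epi (cokernel.π Ψ)),
        hY.cokernel hC hP (J := J') (hJ.biproduct n) Ψ, fun A x => ?_⟩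
      exact app_cokernel_π_eq_zero_iff Ψ x) hY
  exact ⟨S, J, e, i, hi, r', fun n _ => hr' n⟩

end ProjectiveTrace

/-! ### Modules over C/I and vanishing of Ext -/

section QuotientCategory

variable {C : Type u} [SmallCategory C] [Preadditive C] (I : CatIdeal C)

lemma CatIdeal.π_map_eq_zero_iff {A B : C} (f : A ⟶ B) : I.π.map f = 0 ↔ f ∈ I.hom A B := by
  rw [← I.π.map_zero, CategoryTheory.Quotient.functor_map_eq_iff, CatIdeal.rel, sub_zero]

/-- A module killed by an ideal is a module over the quotient category. -/
lemma CatIdeal.exists_iso_restrict {G : Mod C}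
    (hG : ∀ {A B : C} (f : A ⟶ B), f ∈ I.hom A B → G.obj.map f = 0) :
    ∃ F : Mod I.Quot, Nonempty ((restrict I.π).obj F ≅ G) := by
  let L : I.Quot ⥤ AddCommGrpCat.{u} := CategoryTheory.Quotient.lift I.rel G.obj fun A B f g h => by
    have := hG (f - g) h
    rwa [Functor.map_sub, sub_eq_zero] at this
  have hL : L.Additive :=
    { map_add := fun {A B f g} => by
        obtain ⟨f, rfl⟩ := I.π.map_surjective (X := A.as) (Y := B.as) f
        obtain ⟨g, rfl⟩ := I.π.map_surjective (X := A.as) (Y := B.as) g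
        rw [← Functor.map_add]
        exact G.obj.map_add }
  exact ⟨⟨L, hL⟩, ⟨(additiveFunctor C AddCommGrpCat.{u}).isoMk (Iso.refl _)⟩⟩

variable {I}

lemma CatIdeal.restrict_map_apply (F : Mod I.Quot) {A B : C} (f : A ⟶ B)
    (x : F.obj.obj (I.π.obj A)) :
    ((restrict I.π).obj F).obj.map f x = F.obj.map (I.π.map f) x := rfl

variable (I) in
/-- The projection of `Hom_C(A, -)` onto `Hom_{C/I}(A, -)`. -/
def repQuot (A : C) : rep A ⟶ (restrict I.π).obj (rep (I.π.obj A)) :=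
  yon (M := (restrict I.π).obj (rep (I.π.obj A))) (el (𝟙 (I.π.obj A)))

lemma repQuot_app (A : C) {B : C} (f : A ⟶ B) :
    (repQuot I A).hom.app B (el f) = el (I.π.map f) := by
  change (rep (I.π.obj A)).obj.map (I.π.map f) (el (𝟙 (I.π.obj A))) = _
  rw [rep_map, Category.id_comp]

lemma repQuot_app_eq_zero_iff (A : C) {B : C} (f : A ⟶ B) :
    (repQuot I A).hom.app B (el f) = 0 ↔ f ∈ I.hom A B := by
  rw [repQuot_app, ← I.π_map_eq_zero_iff]
  exact map_eq_zero_iff el el.injective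

lemma ι_repQuot (A : C) : (I.homSub A).ι ≫ repQuot I A = 0 :=
  Mod.hom_ext' fun _ y => (repQuot_app_eq_zero_iff A y.1).2 y.2

lemma shortExact_repQuot (A : C) :
    (ShortComplex.mk (I.homSub A).ι (repQuot I A) (ι_repQuot A)).ShortExact where
  exact := (exact_iff _).2 fun B x hx => ⟨⟨x, (repQuot_app_eq_zero_iff A (el.symm x)).1 hx⟩, rfl⟩
  mono_f := inferInstanceAs (Mono (I.homSub A).ι)
  epi_g := (epi_iff _).2 fun B x => by
    obtain ⟨f, hf⟩ := I.π.map_surjective (X := A) (Y := B) (el.symm x)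
    exact ⟨el f, (repQuot_app A f).trans (hf ▸ el.apply_symm_apply x)⟩

open Abelian in
-- Every class over C comes from one over C/I, where the first argument is projective.
lemma ext_repQuot_eq_zero [HasExt.{u + 1} (Mod I.Quot)] [HasExt.{u + 1} (Mod C)] {n : ℕ}
    (h : ∀ F F' : Mod I.Quot, Function.Bijective ((restrict I.π).mapExtAddHom F F' (n + 1)))
    {G : Mod C} (hG : ∀ {A B : C} (f : A ⟶ B), f ∈ I.hom A B → G.obj.map f = 0) (A : C)
    (x : Ext ((restrict I.π).obj (rep (I.π.obj A))) G (n + 1)) : x = 0 := by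
  obtain ⟨F, ⟨e⟩⟩ := I.exists_iso_restrict hG
  obtain ⟨y, hy⟩ := (h _ _).2 (x.comp (Ext.mk₀ e.inv) (add_zero _))
  rw [Ext.eq_zero_of_projective y, map_zero] at hy
  have := congrArg (fun z => z.comp (Ext.mk₀ e.hom) (add_zero _)) hy
  simpa using this.symm

open Abelian in
-- Dimension shift along 0 ⟶ I(A, -) ⟶ Hom(A, -) ⟶ (C/I)(A, -) ⟶ 0; degree n + 1 here uses the
-- comparison in degree n + 2.
lemma ext_homSub_eq_zero [HasExt.{u + 1} (Mod I.Quot)] [HasExt.{u + 1} (Mod C)] {n : ℕ}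
    (h : ∀ F F' : Mod I.Quot, Function.Bijective ((restrict I.π).mapExtAddHom F F' (n + 2)))
    {G : Mod C} (hG : ∀ {A B : C} (f : A ⟶ B), f ∈ I.hom A B → G.obj.map f = 0) (A : C)
    (x : Ext (I.homSub A).toMod G (n + 1)) : x = 0 := by
  obtain ⟨y, rfl⟩ := Ext.contravariant_sequence_exact₁ (shortExact_repQuot (I := I) A) G x
    (n₁ := n + 2) (by omega) (ext_repQuot_eq_zero h hG A _)
  rw [Ext.eq_zero_of_projective (P := rep A) y, Ext.comp_zero]

end QuotientCategory

/-! ### From (a) to projectivity of the trace -/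

section

variable {R : Type u} [CommRing R] {C : Type u} [SmallCategory C] [Preadditive C] [Linear R C]
variable {X : C}

open Abelian

lemma cokernel_shortExact {M N : Mod C} (f : M ⟶ N) [Mono f] :
    (ShortComplex.mk f (cokernel.π f) (cokernel.condition f)).ShortExact where
  exact := ShortComplex.exact_cokernel f

/-- A product a ≫ b through X is the image under b of the element a of I(A, X), so I(A, -) is
generated by its value at X. -/
lemma hom_traceMod_eq_zero {A : C} {T : Mod C} (hT : ∀ x : T.obj.obj X, x = 0)
    (α : traceMod X A ⟶ T) : α = 0 := by
  refine Mod.hom_ext' fun B y => ?_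
  obtain ⟨f, hf⟩ := y
  have : (traceIdeal (rep X)).hom A B ≤
      AddSubgroup.map ((traceIdeal (rep X)).hom A B).subtype (α.hom.app B).hom.ker := by
    refine traceIdeal_hom_le fun a b => ⟨⟨_, comp_mem_traceIdeal a b⟩, ?_, rfl⟩
    exact (app_map α b ⟨a, mem_traceIdeal_of_right a⟩).trans
      ((congrArg (T.obj.map b) (hT _)).trans (map_zero (T.obj.map b).hom))
  obtain ⟨⟨f', hf'⟩, h, rfl⟩ := this hf
  exact h

/-- The torsion free cokernel embeds in a power of J, which supplies the second term; later terms
are arbitrary injective envelopes. -/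
lemma IsDualizingVariety.inI_one_of_exact (hC : IsDualizingVariety R C) {S J : FpMod C}
    (e : S.obj ≅ (rad (rep X)).quotient) {i : S ⟶ J} (hi : IsInjectiveEnvelope i) {Y : FpMod C}
    {n : ℕ} (k : Y.obj ⟶ ⨁ fun _ : Fin n => J.obj) [Mono k] (hk : TorsionFree X (cokernel k)) :
    InI (rep X) 1 Y := by
  have := hC.hasFiniteBiproducts
  have := hi.injective
  obtain ⟨r, hr⟩ := exists_injCoresolution
    (fun l Y => match l with
      | 0 => ∃ (n : ℕ) (k : Y.obj ⟶ ⨁ fun _ : Fin n => J.obj), Mono k ∧ TorsionFree X (cokernel k)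
      | 1 => TorsionFree X Y.obj
      | _ => True)
    (fun l K => l ≤ 1 → add J.obj K.obj)
    (fun l Y hY => by
      have aux : ∀ {n : ℕ} (k : Y.obj ⟶ ⨁ fun _ : Fin n => J.obj), Mono k →
          ∃ (J' : FpMod C) (ε : Y ⟶ J') (Z : FpMod C) (p : J' ⟶ Z),
          Injective J' ∧ add J.obj J'.obj ∧ Mono ε.hom ∧ Epi p.hom ∧
            (TorsionFree X (cokernel k) → TorsionFree X Z.obj) ∧
            ∀ A (x : J'.obj.obj.obj A), p.hom.hom.app A x = 0 ↔ ∃ y, ε.hom.hom.app A y = x := by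
        intro n k hk
        exact ⟨⟨_, isFinPres_biproduct J.property n⟩, ObjectProperty.homMk k,
          ⟨_, isFinPres_cokernel Y.property (isFinPres_biproduct J.property n) k⟩,
          ObjectProperty.homMk (cokernel.π k), FpMod.injective_biproduct n, add_biproduct _ _, hk,
          inferInstanceAs (Epi (cokernel.π k)), id, fun A x => app_cokernel_π_eq_zero_iff k x⟩
      match l, hY with
      | 0, ⟨n, k, hk, hkX⟩ =>
        obtain ⟨J', ε, Z, p, h1, h2, h3, h4, h5, h6⟩ := aux k hk
        exact ⟨J', ε, Z, p, h1, fun _ => h2, h3, h4, h5 hkX, h6⟩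
      | 1, hY =>
        obtain ⟨n, k, hk⟩ := hC.exists_mono_of_torsionFree e hi Y.property hY
        obtain ⟨J', ε, Z, p, h1, h2, h3, h4, h5, h6⟩ := aux k hk
        exact ⟨J', ε, Z, p, h1, fun _ => h2, h3, h4, trivial, h6⟩
      | l + 2, _ =>
        obtain ⟨J', ε, hε⟩ := hC.exists_injectiveEnvelope Y
        have hm := (FpMod.mono_iff ε).1 hε.mono
        exact ⟨J', ε, ⟨_, isFinPres_cokernel Y.property J'.property ε.hom⟩,
          ObjectProperty.homMk (cokernel.π ε.hom), hε.injective, fun h => by omega, hm,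
          inferInstanceAs (Epi (cokernel.π ε.hom)), trivial,
          fun A x => app_cokernel_π_eq_zero_iff ε.hom x⟩)
    (Y := Y) ⟨n, k, inferInstance, hk⟩
  exact ⟨S, J, e, i, hi, r, fun n hn => hr n (by exact_mod_cast hn)⟩

variable [HasExt.{u + 1} (Mod C)]

/-- J is injective only in mod(C), whereas Ext is taken in Mod(C). The finitely presented syzygy of
I(A, -) bridges the gap. -/
lemma IsDualizingVariety.ext_traceMod_injective (hC : IsDualizingVariety R C) {J : FpMod C}
    [Injective J] (A : C) (x : Ext (traceMod X A) J.obj 1) : x = 0 := by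
  obtain ⟨-, W, K, k, p, w, hK, hS⟩ := hC.exists_traceMod_presentation X A
  have := hS.mono_f
  obtain ⟨y, rfl⟩ := Ext.contravariant_sequence_exact₃ hS J.obj x
    (Ext.eq_zero_of_projective (P := rep W) _) (n₀ := 0) rfl
  obtain ⟨f, rfl⟩ := (Ext.mk₀_bijective _ _).2 y
  obtain ⟨f', rfl⟩ := FpMod.exists_extension hK (isFinPres_rep W) k f
  rw [← Ext.mk₀_comp_mk₀]
  exact hS.extClass_comp_assoc _

lemma IsDualizingVariety.ext_traceMod_of_inI_top (hC : IsDualizingVariety R C) {Y : FpMod C}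
    (hY : InI (rep X) ⊤ Y) (A : C) (x : Ext (traceMod X A) Y.obj 1) : x = 0 := by
  obtain ⟨S, J, e, i, hi, r, hr⟩ := hY
  have := hC.hasFiniteBiproducts
  have hJ : TorsionFree X J.obj :=
    ((torsionFree_rep_quotient_rad X).of_mono e.hom).of_envelope hi
  have := r.mono
  have := r.injective 0
  have := r.injective 1
  have hS := cokernel_shortExact r.ε.hom
  obtain ⟨y, rfl⟩ := Ext.covariant_sequence_exact₁ _ hS x (hC.ext_traceMod_injective A _)
    (n₀ := 0) rfl
  obtain ⟨α, rfl⟩ := (Ext.mk₀_bijective _ _).2 y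
  let m : cokernel r.ε.hom ⟶ (r.J 1).obj := cokernel.desc r.ε.hom (r.d 0).hom r.ε_d
  have hm : Mono m := by
    rw [mono_iff]
    intro B z hz
    obtain ⟨w, rfl⟩ := (epi_iff (cokernel.π r.ε.hom)).1 inferInstance B z
    rw [← comp_app, cokernel.π_desc] at hz
    rw [app_cokernel_π_eq_zero_iff]
    exact (exact_iff _).1 r.exact_zero B w hz
  -- The class comes from α : I(A, -) ⟶ J₀/Y. Torsion freeness of J₂ lets α extend to Hom(A, -), and
  -- projectivity of the latter lifts the extension to J₀, so the class is zero.
  obtain ⟨β, hβ⟩ := FpMod.exists_extension (hC.exists_traceMod_presentation X A).1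
    (isFinPres_rep A) (traceι X A) (α ≫ m)
  obtain ⟨γ, hγ⟩ := exists_extension_of_exact (K := (r.J 2).obj) m (r.d 1).hom
    (fun B y => ⟨fun hy => by
      obtain ⟨w, rfl⟩ := (exact_iff _).1 (r.exact_succ 0) B y hy
      exact ⟨(cokernel.π r.ε.hom).hom.app B w, by rw [← comp_app, cokernel.π_desc]⟩, by
      rintro ⟨z, rfl⟩
      obtain ⟨w, rfl⟩ := (epi_iff (cokernel.π r.ε.hom)).1 inferInstance B z
      rw [← comp_app (cokernel.π r.ε.hom) m, cokernel.π_desc, ← comp_app, r.d_d 0, zero_app]⟩)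
    (hJ.of_add (hr 2 le_top)) α β hβ
  have hα : α = (traceι X A ≫ Projective.factorThru γ (cokernel.π r.ε.hom)) ≫
      cokernel.π r.ε.hom := by
    rw [Category.assoc, Projective.factorThru_comp, ← cancel_mono m, Category.assoc, hγ, hβ]
  rw [hα, ← Ext.mk₀_comp_mk₀, Ext.comp_assoc_of_second_deg_zero]
  rw [hS.comp_extClass, Ext.comp_zero]

/-- Y is enlarged inside J^n to Y', the preimage of the torsion of J^n/Y. Then Y' is in 𝕀₁ = 𝕀_∞,
and Y'/Y vanishes at X, so it receives no nonzero map from I(A, -). -/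
lemma IsDualizingVariety.ext_traceMod_of_torsionFree (hC : IsDualizingVariety R C)
    (hI : InI (rep X) 1 = InI (rep X) ⊤) {Y : Mod C} (hY : IsFinPres Y) (hYX : TorsionFree X Y)
    (A : C) (x : Ext (traceMod X A) Y 1) : x = 0 := by
  have := hC.hasFiniteBiproducts
  obtain ⟨S, J, e, i, hi⟩ := hC.exists_topEnvelope X
  have hJ : TorsionFree X J.obj :=
    ((torsionFree_rep_quotient_rad X).of_mono e.hom).of_envelope hi
  obtain ⟨n, Ψ, hΨ⟩ := hC.exists_mono_of_torsionFree e hi hY hYX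
  have hJn := isFinPres_biproduct J.property n
  obtain ⟨n', Ψ', hΨ'⟩ := hC.exists_kernel_torsion e hi (isFinPres_cokernel hY hJn Ψ)
  obtain ⟨Y', k, hY', hk, hk'⟩ := hC.exists_kernel hJn (isFinPres_biproduct J.property n')
    (cokernel.π Ψ ≫ Ψ')
  obtain ⟨j, hj⟩ := exists_lift_of_mono k Ψ fun B y => by
    rw [← hk', comp_app, (app_cokernel_π_eq_zero_iff Ψ _).2 ⟨y, rfl⟩, map_zero]
  have : Mono j := by
    have : Mono (j ≫ k) := by rwa [hj]
    exact mono_of_mono j k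
  have hInI : InI (rep X) 1 (⟨Y', hY'⟩ : FpMod C) := by
    refine hC.inI_one_of_exact e hi (Y := ⟨Y', hY'⟩) k fun B z hz => ?_
    obtain ⟨w, rfl⟩ := (epi_iff (cokernel.π k)).1 inferInstance B z
    rw [app_cokernel_π_eq_zero_iff, ← hk']
    refine hJ.biproduct n' B _ fun g => ?_
    rw [← app_map, hk', ← app_cokernel_π_eq_zero_iff, app_map]
    exact hz g
  rw [hI] at hInI
  have hT : ∀ t : (cokernel j).obj.obj X, t = 0 := fun t => by
    obtain ⟨y', rfl⟩ := (epi_iff (cokernel.π j)).1 inferInstance X t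
    have h1 := (hk' X (k.hom.app X y')).2 ⟨y', rfl⟩
    rw [comp_app, hΨ'] at h1
    have h2 := h1 (𝟙 X)
    rw [map_id_apply, app_cokernel_π_eq_zero_iff] at h2
    obtain ⟨y, hy⟩ := h2
    rw [app_cokernel_π_eq_zero_iff]
    exact ⟨y, app_injective k (by rw [← comp_app, hj, hy])⟩
  obtain ⟨y, rfl⟩ := Ext.covariant_sequence_exact₁ _ (cokernel_shortExact j) x
    (hC.ext_traceMod_of_inI_top hInI A _) (n₀ := 0) rfl
  obtain ⟨α, rfl⟩ := (Ext.mk₀_bijective _ _).2 y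
  rw [hom_traceMod_eq_zero hT α, Ext.mk₀_zero, Ext.zero_comp]

/-- Y is an extension of a torsion free module by its torsion submodule K. The latter is killed by
I, so idempotence in degree 2 handles it. -/
lemma IsDualizingVariety.ext_traceMod_eq_zero (hC : IsDualizingVariety R C)
    [HasExt.{u + 1} (Mod (traceIdeal (rep X)).Quot)]
    (h : ∀ F F' : Mod (traceIdeal (rep X)).Quot,
      Function.Bijective ((restrict (traceIdeal (rep X)).π).mapExtAddHom F F' 2))
    (hI : InI (rep X) 1 = InI (rep X) ⊤) {Y : Mod C} (hY : IsFinPres Y)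
    (A : C) (x : Ext (traceMod X A) Y 1) : x = 0 := by
  have := hC.hasFiniteBiproducts
  obtain ⟨S, J, e, i, hi⟩ := hC.exists_topEnvelope X
  obtain ⟨n, Ψ, hΨ⟩ := hC.exists_kernel_torsion e hi hY
  obtain ⟨K, k, hK, hk, hk'⟩ := hC.exists_kernel hY (isFinPres_biproduct J.property n) Ψ
  have hKX : ∀ {A : C} (y : K.obj.obj A) (g : A ⟶ X), K.obj.map g y = 0 := fun {A} y g => by
    apply (mono_iff k).1 hk
    rw [app_map]
    exact (hΨ A _).1 ((hk' A _).2 ⟨y, rfl⟩) g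
  have hZ : TorsionFree X (cokernel k) := fun B z hz => by
    obtain ⟨w, rfl⟩ := (epi_iff (cokernel.π k)).1 inferInstance B z
    rw [app_cokernel_π_eq_zero_iff, ← hk', hΨ]
    intro g
    have h1 := hz g
    rw [← app_map, app_cokernel_π_eq_zero_iff, ← hk', hΨ] at h1
    have h2 := h1 (𝟙 X)
    rwa [map_id_apply] at h2
  obtain ⟨y, rfl⟩ := Ext.covariant_sequence_exact₂ _ (cokernel_shortExact k) x
    (hC.ext_traceMod_of_torsionFree hI (isFinPres_cokernel hK hY k) hZ A _)
  rw [ext_homSub_eq_zero (n := 0) h (fun f hf => ConcreteCategory.hom_ext _ _ fun y =>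
    map_eq_zero_of_mem_traceIdeal (hKX y) hf) A y, Ext.zero_comp]

lemma IsDualizingVariety.projective_traceMod (hC : IsDualizingVariety R C)
    [HasExt.{u + 1} (Mod (traceIdeal (rep X)).Quot)]
    (h : ∀ F F' : Mod (traceIdeal (rep X)).Quot,
      Function.Bijective ((restrict (traceIdeal (rep X)).π).mapExtAddHom F F' 2))
    (hI : InI (rep X) 1 = InI (rep X) ⊤) (A : C) : Projective (traceMod X A) := by
  obtain ⟨-, W, K, k, p, w, hK, hS⟩ := hC.exists_traceMod_presentation X A
  obtain ⟨y, hy⟩ := Ext.covariant_sequence_exact₃ _ hS (Ext.mk₀ (𝟙 (traceMod X A))) (n₁ := 1) rfl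
    (hC.ext_traceMod_eq_zero h hI hK A _)
  obtain ⟨s, rfl⟩ := (Ext.mk₀_bijective _ _).2 y
  rw [Ext.mk₀_comp_mk₀] at hy
  exact Retract.projective (Y := rep W) ⟨s, p, (Ext.mk₀_bijective _ _).1 hy⟩

end

/-! ### Exactness of coproducts in Mod(C) -/

section Coproducts

variable {C : Type u} [SmallCategory C] [Preadditive C]

instance closedUnderCoproducts (ι : Type u) :
    (additiveFunctor C AddCommGrpCat.{u}).IsClosedUnderColimitsOfShape (Discrete ι) where
  colimitsOfShape_le := by
    rintro F ⟨h⟩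
    refine { map_add := fun {X Y f g} => ?_ }
    refine (isColimitOfPreserves ((evaluation C AddCommGrpCat.{u}).obj X) h.isColimit).hom_ext
      fun j => ?_
    have := h.prop_diag_obj j
    have : (h.diag.obj j).Additive := this
    simp [Preadditive.comp_add, ← NatTrans.naturality]

instance (ι : Type u) : HasColimitsOfShape (Discrete ι) (Mod C) := inferInstance

instance (ι : Type u) : HasExactColimitsOfShape (Discrete ι) (Mod C) :=
  have : PreservesFiniteLimits (AdditiveFunctor.forget C AddCommGrpCat.{u}) :=
    ⟨fun _ _ _ => inferInstance⟩
  have : ReflectsFiniteLimits (AdditiveFunctor.forget C AddCommGrpCat.{u}) :=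
    ⟨fun _ _ _ => inferInstance⟩
  HasExactColimitsOfShape.domain_of_functor (Discrete ι) (AdditiveFunctor.forget C AddCommGrpCat.{u})

lemma mono_sigmaMap {ι : Type u} {M N : ι → Mod C} (f : ∀ j, M j ⟶ N j) [∀ j, Mono (f j)] :
    Mono (Limits.Sigma.map f) := by
  have : ∀ j, Mono ((Discrete.natTrans (F := Discrete.functor M) (G := Discrete.functor N)
    fun j => f j.as).app j) := fun j => inferInstanceAs (Mono (f j.as))
  have : Mono (Discrete.natTrans (F := Discrete.functor M) (G := Discrete.functor N)
    fun j => f j.as) := NatTrans.mono_of_mono_app _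
  exact inferInstanceAs (Mono (colim.map (Discrete.natTrans (F := Discrete.functor M)
    (G := Discrete.functor N) fun j => f j.as)))

end Coproducts

/-! ### Comparison of Ext along an exact embedding -/

section Acyclic

open Abelian

universe v v' w w' u₁ u₂

/-- A fully faithful exact functor induces isomorphisms on `Ext` groups if there are enough
projectives which it sends to acyclic objects. -/
lemma mapExt_bijective_of_acyclic {A : Type u₁} [Category.{v} A] [Abelian A] {B : Type u₂}
    [Category.{v'} B] [Abelian B] (F : A ⥤ B) [F.Additive] [PreservesFiniteLimits F]
    [PreservesFiniteColimits F] [F.Full] [F.Faithful] [HasExt.{w} A] [HasExt.{w'} B]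
    (h : ∀ X : A, ∃ (Q : A) (q : Q ⟶ X), Epi q ∧ Projective Q ∧
      ∀ (Y : A) (n : ℕ) (x : Ext (F.obj Q) (F.obj Y) (n + 1)), x = 0)
    (X Y : A) (n : ℕ) : Function.Bijective (F.mapExtAddHom X Y n) := by
  induction n generalizing X with
  | zero =>
    simpa [Ext.mapExactFunctor₀] using ⟨F.map_injective, F.map_surjective⟩
  | succ n hn =>
    obtain ⟨Q, q, hq, hQ, hQ'⟩ := h X
    let S := ShortComplex.mk _ _ (kernel.condition q)
    have hS : S.ShortExact := { exact := ShortComplex.exact_kernel q }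
    refine ⟨?_, fun y => ?_⟩
    · rw [injective_iff_map_eq_zero]
      intro x hx
      obtain ⟨f, rfl⟩ := Ext.contravariant_sequence_exact₃ hS Y x (Ext.eq_zero_of_projective _)
        (add_comm 1 n)
      rw [Functor.mapExtAddHom_apply, Ext.mapExactFunctor_comp, Ext.mapExactFunctor_extClass] at hx
      -- The image of f extends to a class on F(Q). By the induction hypothesis for Q and for the
      -- kernel, f itself then extends to Q, so its connecting image is zero.
      obtain ⟨g, hg⟩ := Ext.contravariant_sequence_exact₁ (hS.map_of_exact F) (F.obj Y) _
        (add_comm 1 n) hx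
      obtain ⟨g, rfl⟩ := (hn Q).2 g
      have : (Ext.mk₀ S.f).comp g (zero_add n) = f := by
        apply (hn _).1
        rw [Functor.mapExtAddHom_apply, Functor.mapExtAddHom_apply, ← hg,
          Ext.mapExactFunctor_comp, Ext.mapExactFunctor_mk₀]
        rfl
      rw [← this]
      exact hS.extClass_comp_assoc _
    · obtain ⟨f, rfl⟩ := Ext.contravariant_sequence_exact₃ (hS.map_of_exact F) (F.obj Y) y
        (hQ' Y n _) (add_comm 1 n)
      obtain ⟨f, rfl⟩ := (hn _).2 f
      refine ⟨hS.extClass.comp f (add_comm 1 n), ?_⟩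
      rw [Functor.mapExtAddHom_apply, Ext.mapExactFunctor_comp, Ext.mapExactFunctor_extClass]
      rfl

end Acyclic

/-! ### Projective traces give idempotence -/

section Idempotent

open Abelian

variable {C : Type u} [SmallCategory C] [Preadditive C]

instance (I : CatIdeal C) : (restrict I.π).Faithful where
  map_injective {F F'} _ _ h := Mod.hom_ext' fun A x =>
    congrArg (fun α : (restrict I.π).obj F ⟶ (restrict I.π).obj F' => α.hom.app A.as x) h

instance (I : CatIdeal C) : (restrict I.π).Full where
  map_surjective {_ _} φ :=
    ⟨ObjectProperty.homMk (CategoryTheory.Quotient.natTransLift I.rel φ.hom),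
      Mod.hom_ext' fun _ _ => rfl⟩

variable {X : C}

lemma restrict_obj_eq_zero (F : Mod (traceIdeal (rep X)).Quot)
    (x : ((restrict (traceIdeal (rep X)).π).obj F).obj.obj X) : x = 0 := by
  have h : (traceIdeal (rep X)).π.map (𝟙 X) = 0 :=
    (CatIdeal.π_map_eq_zero_iff _ _).2 (mem_traceIdeal_of_right _)
  have h1 := CatIdeal.restrict_map_apply F (𝟙 X) x
  rw [map_id_apply, h] at h1
  exact h1.trans (map_zero_apply F x)

/-- P is the coproduct of representables indexed by all elements of F, and Q is its quotient by the
corresponding coproduct N of modules I(A, -). Maps from P to a C/I-module kill N, so they factor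
through Q; this makes Q projective over C/I. -/
lemma exists_acyclic_cover (hP : ∀ A : C, Projective (traceMod X A))
    (F : Mod (traceIdeal (rep X)).Quot) :
    ∃ (Q : Mod (traceIdeal (rep X)).Quot) (q : Q ⟶ F) (N P : Mod C) (i : N ⟶ P)
      (z : P ⟶ (restrict (traceIdeal (rep X)).π).obj Q) (w : i ≫ z = 0),
      Epi q ∧ Projective Q ∧ Projective N ∧ Projective P ∧ (ShortComplex.mk i z w).ShortExact ∧
        ∀ (G : Mod C) (_ : ∀ x : G.obj.obj X, x = 0) (α : N ⟶ G), α = 0 := by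
  let I := traceIdeal (rep X)
  let ι : Type u := Σ A : C, ((restrict I.π).obj F).obj.obj A
  let P : Mod C := ∐ fun j : ι => rep j.1
  let N : Mod C := ∐ fun j : ι => traceMod X j.1
  let i : N ⟶ P := Limits.Sigma.map fun j : ι => traceι X j.1
  have hi : Mono i := mono_sigmaMap _
  have hij : ∀ j : ι, Sigma.ι (fun j : ι => traceMod X j.1) j ≫ i =
      traceι X j.1 ≫ Sigma.ι (fun j : ι => rep j.1) j := fun j => by simp [i]
  have hN : ∀ (G : Mod C) (_ : ∀ x : G.obj.obj X, x = 0) (α : N ⟶ G), α = 0 := fun G hG α =>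
    Sigma.hom_ext _ _ fun j => by rw [comp_zero, hom_traceMod_eq_zero hG (_ ≫ α)]
  let p : P ⟶ cokernel i := cokernel.π i
  have hip : i ≫ p = 0 := cokernel.condition i
  -- The cokernel is all torsion: its generators are killed by every g : A ⟶ X, as g lies in I(A,
  -- X).
  have htors : (torsion X (cokernel i)).π = 0 := by
    rw [← cancel_epi p, comp_zero]
    refine Sigma.hom_ext _ _ fun j => ?_
    rw [comp_zero, ← Category.assoc, ← yon_elt (Sigma.ι (fun j : ι => rep j.1) j ≫ p), yon_comp]
    rw [(Sub.π_app_eq_zero _ _).2, yon_zero]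
    intro g
    obtain ⟨y, hy⟩ := exists_traceι_app (mem_traceIdeal_of_right g)
    rw [← app_el, ← hy, ← comp_app (traceι X j.1), ← Category.assoc, ← hij, Category.assoc, hip,
      comp_zero, zero_app]
  obtain ⟨Q, ⟨e⟩⟩ := I.exists_iso_restrict (G := cokernel i) fun f hf =>
    ConcreteCategory.hom_ext _ _ fun x => map_eq_zero_of_mem_traceIdeal (fun g => by
      have := (Sub.π_app_eq_zero (torsion X (cokernel i)) x).1 (by rw [htors, zero_app])
      exact this g) hf
  let z : P ⟶ (restrict I.π).obj Q := p ≫ e.inv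
  have hz : i ≫ z = 0 := by rw [reassoc_of% hip, zero_comp]
  have hze : Epi z := inferInstanceAs (Epi (p ≫ e.inv))
  have hdesc : ∀ (G : Mod I.Quot) (l : P ⟶ (restrict I.π).obj G),
      ∃ l' : Q ⟶ G, z ≫ (restrict I.π).map l' = l := by
    intro G l
    have hl : i ≫ l = 0 := hN _ (restrict_obj_eq_zero G) _
    obtain ⟨l', hl'⟩ := (restrict I.π).map_surjective (e.hom ≫ cokernel.desc i l hl)
    refine ⟨l', ?_⟩
    rw [hl', Category.assoc, e.inv_hom_id_assoc]
    exact cokernel.π_desc i l hl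
  obtain ⟨q, hq⟩ := hdesc F (Sigma.desc fun j : ι => yon j.2)
  refine ⟨Q, q, N, P, i, z, hz, ?_, ⟨fun {E G} f g hg => ?_⟩, inferInstance, inferInstance, ?_, hN⟩
  · rw [epi_iff]
    intro A x
    let j : ι := ⟨A.as, x⟩
    have h1 : (Sigma.ι (fun j : ι => rep j.1) j ≫ z) ≫ (restrict I.π).map q = yon j.2 := by
      rw [Category.assoc, hq, Sigma.ι_desc]
    refine ⟨(Sigma.ι (fun j : ι => rep j.1) j ≫ z).hom.app A.as (el (𝟙 _)), ?_⟩
    have h2 := congrArg elt h1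
    rw [elt_yon] at h2
    exact h2
  · let l : P ⟶ (restrict I.π).obj E := Projective.factorThru (z ≫ (restrict I.π).map f)
      ((restrict I.π).map g)
    have hl : l ≫ (restrict I.π).map g = z ≫ (restrict I.π).map f := Projective.factorThru_comp _ _
    obtain ⟨l', hl'⟩ := hdesc E l
    refine ⟨l', (restrict I.π).map_injective ?_⟩
    rw [← cancel_epi z, Functor.map_comp, reassoc_of% hl', hl]
  · exact
      { exact := by
          refine (ShortComplex.exact_iff_of_iso (ShortComplex.isoMk (S₁ := ShortComplex.mk i p hip)
            (S₂ := ShortComplex.mk i z hz) (Iso.refl _) (Iso.refl _) e.symm ?_ ?_)).1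
            (ShortComplex.exact_cokernel i)
          · simp
          · simp [z] }

/-- In degree 1, Ext from Q is a quotient of Hom(N, -), which is zero on C/I-modules; in higher
degrees it vanishes because N and P are projective. -/
lemma mapExt_restrict_bijective [HasExt.{u + 1} (Mod (traceIdeal (rep X)).Quot)]
    [HasExt.{u + 1} (Mod C)] (hP : ∀ A : C, Projective (traceMod X A))
    (F F' : Mod (traceIdeal (rep X)).Quot) (n : ℕ) :
    Function.Bijective ((restrict (traceIdeal (rep X)).π).mapExtAddHom F F' n) := by
  refine mapExt_bijective_of_acyclic _ (fun F => ?_) F F' n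
  obtain ⟨Q, q, N, P, i, z, w, hq, hQ, hN, hP, hS, hN0⟩ := exists_acyclic_cover hP F
  refine ⟨Q, q, hq, hQ, fun Y n x => ?_⟩
  obtain ⟨y, rfl⟩ := Ext.contravariant_sequence_exact₃ hS _ x
    (Ext.eq_zero_of_projective (P := P) _) (add_comm 1 n)
  cases n with
  | zero =>
    obtain ⟨α, rfl⟩ := (Ext.mk₀_bijective _ _).2 y
    rw [hN0 _ (restrict_obj_eq_zero Y) α, Ext.mk₀_zero, Ext.comp_zero]
  | succ n => rw [Ext.eq_zero_of_projective (P := N) y, Ext.comp_zero]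

end Idempotent

end RMod

end

theorem mainTheorem7 (R : Type u) [CommRing R] (C : Type u) [SmallCategory C] [Preadditive C]
    [Linear R C] (hC : RMod.IsDualizingVariety R C) (X : C) :
    ((RMod.traceIdeal (RMod.rep X)).IsIdempotent 2 ∧
      RMod.InI (RMod.rep X) 1 = RMod.InI (RMod.rep X) ⊤) ↔
    ∀ X' : C, Projective ((RMod.traceIdeal (RMod.rep X)).homSub X').toMod := by
  let _ : HasExt.{u + 1} (RMod.Mod (RMod.traceIdeal (RMod.rep X)).Quot) := HasExt.standard _
  let _ : HasExt.{u + 1} (RMod.Mod C) := HasExt.standard _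
  constructor
  · rintro ⟨h, hI⟩ A
    exact hC.projective_traceMod (fun F F' => h F F' 2 le_rfl) hI A
  · intro hP
    exact ⟨fun F F' n _ => RMod.mapExt_restrict_bijective hP F F' n, hC.inI_one_eq_top hP⟩
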